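/- **Setting.** Let $(L,X)$ be a metric space of diameter at most $1$. An instance of the Lipschitz MAB problem assigns to every strategy $x\in X$ a payoff distribution supported in $[0,1]$ with mean $\mu(x)$, where $|\mu(x)-\mu(y)|\le L(x,y)$ for all $x,y\in X$. In each round an algorithm chooses a strategy $x$ and observes an independent sample from the payoff distribution of $x$. Let $\mu^*=\sup_{x\in X}\mu(x)$. The regret $R(t)$ is $t\mu^*$ minus the expected total payoff in the first $t$ rounds. For $C>0$, the $C$-zooming dimension of the instance is the smallest $d\ge 0$ such that for every $r\in(0,1]$ the set $\{x\in X:\ r/2<\mu^*-\mu(x)\le r\}$ can be covered by at most $C\,r^{-d}$ sets of diameter at most $r/8$ (and $d=\infty$ if there is no such $d$). **Zooming algorithm.** The algorithm runs in phases $i=1,2,3,\dots$, phase $i$ lasting $2^i$ rounds. At round $t$ of phase $i$, let $n_t(v)$ be the number of earlier plays of $v$ in this phase, $\mu_t(v)$ the average reward of these plays ($0$ if there are none), $r_t(v)=\sqrt{8i/(2+n_t(v))}$ and $I_t(v)=\mu_t(v)+2r_t(v)$. A strategy $u$ is covered if $L(u,v)<r_t(v)$ for some active strategy $v$. No strategy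 is active at the beginning of a phase. In each round: (1) if some strategy is not covered, one such strategy, chosen arbitrarily, is made active; (2) an active strategy $v$ with maximal $I_t(v)$ is played, with ties broken arbitrarily. (The arbitrary choices may be randomized and may depend on the past.) **Theorem.** There is an absolute constant $K>0$ such that for every instance of the Lipschitz MAB problem, every execution of the zooming algorithm on it, every $C>0$ and every integer $t\ge 2$, $$R(t)\ \le\ (K\,C\log t)^{1/(d+2)}\; t^{\,1-1/(d+2)},$$ where $d\in[0,\infty]$ is the $C$-zooming dimension of the instance (and $1/(d+2)=0$ if $d=\infty$). The algorithm does not depend on $C$ or $d$. -/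

import Mathlib

open MeasureTheory ProbabilityTheory
open scoped ENNReal NNReal

/-- An instance of the Lipschitz multi-armed bandit problem on a metric space `X`
(with similarity function `dist`, of diameter at most `1`): every strategy `x` has a payoff
distribution supported in `[0, 1]` with expectation `μ x`, and `μ` is `1`-Lipschitz. -/
structure LipschitzMAB (X : Type*) [MetricSpace X] where
  /-- the payoff distribution of each strategy -/
  payoff : X → Measure ℝ
  /-- the expected payoff of each strategy -/
  μ : X → ℝ
  dist_le_one : ∀ x y : X, dist x y ≤ 1
  isProbabilityMeasure_payoff : ∀ x, IsProbabilityMeasure (payoff x)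
  support_payoff : ∀ x, ∀ᵐ y ∂(payoff x), y ∈ Set.Icc (0 : ℝ) 1
  mean_payoff : ∀ x, ∫ y, y ∂(payoff x) = μ x
  lipschitz : ∀ x y : X, |μ x - μ y| ≤ dist x y

namespace LipschitzMAB

noncomputable section

variable {X : Type*} [MetricSpace X]

/-- The maximal expected reward `μ* = sup_x μ(x)`. -/
def maxReward (I : LipschitzMAB X) : ℝ := ⨆ x, I.μ x

/-- The set `X_r` of strategies `x` with `r / 2 < μ* - μ(x) ≤ r`. -/
def nearOptimal (I : LipschitzMAB X) (r : ℝ) : Set X :=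
  {x | r / 2 < I.maxReward - I.μ x ∧ I.maxReward - I.μ x ≤ r}

/-- For every `r ∈ (0, 1]` the set `X_r` can be covered by `C * r ^ (-d)` sets of diameter at
most `r / 8`. (All sets are bounded since `X` has diameter at most `1`.) -/
def ZoomingCovers (I : LipschitzMAB X) (C d : ℝ) : Prop :=
  ∀ r : ℝ, 0 < r → r ≤ 1 → ∃ 𝒰 : Finset (Set X),
    (𝒰.card : ℝ) ≤ C * r ^ (-d) ∧
    (∀ U ∈ 𝒰, Metric.diam U ≤ r / 8) ∧
    I.nearOptimal r ⊆ ⋃ U ∈ 𝒰, U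

/-- The `C`-zooming dimension: the smallest `d ≥ 0` for which the covering property holds, and
`∞` if there is none. -/
def zoomingDim (I : LipschitzMAB X) (C : ℝ) : ℝ≥0∞ :=
  ⨅ (d : ℝ≥0) (_ : I.ZoomingCovers C d), (d : ℝ≥0∞)

end

end LipschitzMAB

namespace Zooming

noncomputable section

/-- Rounds are numbered `0, 1, 2, …` and phases `1, 2, 3, …`. Phase `i` lasts `2 ^ i` rounds, so
it consists of the rounds `t` with `2 ^ i ≤ t + 2 < 2 ^ (i + 1)`. This is the phase of round `t`. -/
def phase (t : ℕ) : ℕ := Nat.log 2 (t + 2)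

/-- The first round of the phase that contains round `t`. -/
def phaseStart (t : ℕ) : ℕ := 2 ^ phase t - 2

variable {X : Type*} [MetricSpace X]

open Classical in
/-- The rounds before `t`, in the phase of `t`, in which `v` was played. -/
def playsOf (play : ℕ → X) (t : ℕ) (v : X) : Finset ℕ :=
  (Finset.Ico (phaseStart t) t).filter fun s => play s = v

/-- The average reward `μ_t(v)` of `v` in the current phase before round `t`; it is `0` if `v`
has not been played in this phase. -/
def avgReward (play : ℕ → X) (reward : ℕ → ℝ) (t : ℕ) (v : X) : ℝ :=
  (∑ s ∈ playsOf play t v, reward s) / ((playsOf play t v).card : ℝ)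

/-- The confidence radius `r_t(v) = √(8 i / (2 + n_t(v)))`, where `i` is the current phase and
`n_t(v)` the number of plays of `v` in this phase before round `t`. -/
def confRadius (play : ℕ → X) (t : ℕ) (v : X) : ℝ :=
  √(8 * (phase t : ℝ) / (2 + ((playsOf play t v).card : ℝ)))

/-- The index `I_t(v) = μ_t(v) + 2 r_t(v)`. -/
def ucbIndex (play : ℕ → X) (reward : ℕ → ℝ) (t : ℕ) (v : X) : ℝ :=
  avgReward play reward t v + 2 * confRadius play t v

/-- The strategy `u` is covered in round `t` by a strategy from the set `S`. -/
def Covered (play : ℕ → X) (t : ℕ) (S : Set X) (u : X) : Prop :=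
  ∃ v ∈ S, u ∈ Metric.ball v (confRadius play t v)

/-- The active strategies at the very start of round `t`, where `active s` is the set of active
strategies after the activation step of round `s`. No strategy is active when a phase begins. -/
def activeBefore (active : ℕ → Set X) (t : ℕ) : Set X :=
  if t = phaseStart t then ∅ else active (t - 1)

/-- A sequence of plays, rewards and active sets that the zooming algorithm can produce. In each
round: (1) if some strategy is not covered by the active ones, one uncovered strategy (any)
is made active; (2) an active strategy of maximal index is played (ties are broken in any way). -/
def IsTrace (play : ℕ → X) (reward : ℕ → ℝ) (active : ℕ → Set X) : Prop :=
  ∀ t : ℕ,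
    (((∀ u, Covered play t (activeBefore active t) u) ∧ active t = activeBefore active t) ∨
      ∃ u, ¬ Covered play t (activeBefore active t) u ∧
        active t = insert u (activeBefore active t)) ∧
    play t ∈ active t ∧
    ∀ v ∈ active t, ucbIndex play reward t v ≤ ucbIndex play reward t (play t)

/-- An execution of the zooming algorithm on the instance `I`, on a probability space `(Ω, P)`.
The choices that the algorithm leaves open may be random and may depend on the past. -/
structure Run (I : LipschitzMAB X) {Ω : Type*} [mΩ : MeasurableSpace Ω] (P : Measure Ω) where
  /-- `history t` is what is known just before the reward of round `t` is drawn: the past rewards,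
  the plays up to and including round `t`, and any internal randomness used so far -/
  history : Filtration ℕ mΩ
  play : ℕ → Ω → X
  reward : ℕ → Ω → ℝ
  active : ℕ → Ω → Set X
  play_measurable : ∀ t, StronglyMeasurable[history t] (play t)
  reward_measurable : ∀ t, Measurable[history (t + 1)] (reward t)
  /-- given the history, the reward of round `t` is a fresh sample from the payoff distribution
  of the strategy played in round `t` (conditional law, tested on bounded measurable functions) -/
  reward_law : ∀ (t : ℕ) (f : ℝ → ℝ), Measurable f → (∃ M, ∀ y, |f y| ≤ M) →
    P[fun ω => f (reward t ω) | history t] =ᵐ[P] fun ω => ∫ y, f y ∂(I.payoff (play t ω))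
  trace : ∀ᵐ ω ∂P, IsTrace (fun t => play t ω) (fun t => reward t ω) (fun t => active t ω)

/-- The regret in the first `t` rounds: `t μ*` minus the expected total payoff. -/
def Run.regret {I : LipschitzMAB X} {Ω : Type*} [MeasurableSpace Ω] {P : Measure Ω}
    (A : Run I P) (t : ℕ) : ℝ :=
  t * I.maxReward - ∫ ω, (∑ s ∈ Finset.range t, A.reward s ω) ∂P

end

end Zooming

/-!
The analysis follows the plays of the zooming algorithm phase by phase. Write `Δ(x) = μ* - μ(x)`
for the gap of a strategy, `α = 1 / (d + 2)`, and consider `T ≤ 2 ^ i` rounds of phase `i`.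

*Clean rounds.* Suppose that all averages are within the confidence radii of the expectations.
Since the whole space is covered after each activation, the played strategy `v` satisfies
`Δ(v) ≤ 3 r_t(v)` (`IsTrace.gap_le`). Hence `v` is played at most `72 i / Δ(v)²` times, and its
radius never falls much below `Δ(v) / 3`. As strategies are activated only outside the balls around
the active ones, any two active strategies of `X_r` are more than `r / 8` apart
(`IsTrace.dist_sq_ge`), so a cover of `X_r` shows that at most `C r ^ (-d)` of them are played.
Summing over scales bounds the regret above any level `δ`, that is the sum of `(Δ - δ)⁺` over the
rounds, by a multiple of `i C α δ ^ (-(d + 1))` (`IsTrace.sum_excess_le`).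

*Concentration.* The strategy to which a deviation refers is random, and the space may be
uncountable. It is identified by the round `s₀` in which it is first played: for a fixed `s₀` the
centred rewards of the later plays of that strategy form a martingale difference sequence, with the
exponential supermartingale `Run.expMart`. A union bound over `s₀`, the current round, the number
of plays and the sign gives a bad event of probability at most `2 ^ (-i)`.

*The constant.* The absolute constant stands under the exponent `α`, which may be arbitrarily
small, so every loss has to be of the form `1 + O(α)` or `const ^ α`. With
`δ ^ (d + 2) = 1728 C log t / T` the clean excess is at most `α δ T`. On the bad event the gaps
exceed `δ` by at most `α δ T` as well, because `Δ ^ d ≤ C` whenever `Δ > 0`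
(`LipschitzMAB.ZoomingCovers.gap_rpow_le`). The sum over the phases is controlled by Jensen's
inequality (`sum_rpow_le`).
-/

/-! ### Gaps, covers and the zooming dimension -/

namespace LipschitzMAB

variable {X : Type*} [MetricSpace X]

/-- The badness `μ* - μ(x)` of a strategy. -/
noncomputable def gap (I : LipschitzMAB X) (x : X) : ℝ := I.maxReward - I.μ x

lemma μ_mem_Icc (I : LipschitzMAB X) (x : X) : I.μ x ∈ Set.Icc (0 : ℝ) 1 := by
  have := I.isProbabilityMeasure_payoff x
  rw [← I.mean_payoff x]
  refine ⟨integral_nonneg_of_ae ?_, ?_⟩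
  · filter_upwards [I.support_payoff x] with y hy using hy.1
  · have h : ∫ y, y ∂(I.payoff x) ≤ ∫ _, (1 : ℝ) ∂(I.payoff x) := by
      refine integral_mono_of_nonneg ?_ (integrable_const _) ?_
      · filter_upwards [I.support_payoff x] with y hy using hy.1
      · filter_upwards [I.support_payoff x] with y hy using hy.2
    simpa using h

lemma bddAbove_range_μ (I : LipschitzMAB X) : BddAbove (Set.range I.μ) :=
  ⟨1, by rintro _ ⟨x, rfl⟩; exact (I.μ_mem_Icc x).2⟩

lemma gap_nonneg (I : LipschitzMAB X) (x : X) : 0 ≤ I.gap x :=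
  sub_nonneg.2 (le_ciSup I.bddAbove_range_μ x)

lemma gap_le_one (I : LipschitzMAB X) (x : X) : I.gap x ≤ 1 := by
  have : Nonempty X := ⟨x⟩
  have h1 : I.maxReward ≤ 1 := ciSup_le fun y => (I.μ_mem_Icc y).2
  have h2 := (I.μ_mem_Icc x).1
  unfold gap; linarith

lemma gap_le_of_forall (I : LipschitzMAB X) (x : X) {b : ℝ} (h : ∀ u, I.μ u ≤ I.μ x + b) :
    I.gap x ≤ b := by
  have : Nonempty X := ⟨x⟩
  have h1 : I.maxReward ≤ I.μ x + b := ciSup_le h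
  unfold gap; linarith

lemma continuous_μ (I : LipschitzMAB X) : Continuous I.μ :=
  (LipschitzWith.of_dist_le_mul (K := 1) fun x y => by
    simpa [Real.dist_eq] using I.lipschitz x y).continuous

/-- A nonempty `X_r` needs at least one covering set, so the covering property with constant `C`
bounds all gaps, even when `C` is small. -/
lemma ZoomingCovers.gap_rpow_le {I : LipschitzMAB X} {C d : ℝ}
    (hcov : I.ZoomingCovers C d) {x : X} (hx : 0 < I.gap x) : I.gap x ^ d ≤ C := by
  obtain ⟨𝒰, hcard, -, hsub⟩ := hcov (I.gap x) hx (I.gap_le_one x)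
  have hmem : x ∈ I.nearOptimal (I.gap x) := ⟨by change _ < I.gap x; linarith, le_rfl⟩
  have hpos : 1 ≤ 𝒰.card := by
    obtain ⟨U, hU, -⟩ := Set.mem_iUnion₂.1 (hsub hmem)
    exact Finset.card_pos.2 ⟨U, hU⟩
  have h1 : (1 : ℝ) ≤ C * I.gap x ^ (-d) := le_trans (by exact_mod_cast hpos) hcard
  rw [Real.rpow_neg hx.le, ← div_eq_mul_inv, le_div_iff₀ (by positivity)] at h1
  simpa using h1

/-- Points of `X_r` at mutual distance more than `r / 8` lie in different sets of a cover. -/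
lemma ZoomingCovers.card_le {I : LipschitzMAB X} {C d r : ℝ}
    (hcov : I.ZoomingCovers C d) (hr : 0 < r) (hr1 : r ≤ 1) (S : Finset X)
    (hS : ∀ x ∈ S, x ∈ I.nearOptimal r)
    (hsep : ∀ x ∈ S, ∀ y ∈ S, x ≠ y → r / 8 < dist x y) :
    (S.card : ℝ) ≤ C * r ^ (-d) := by
  obtain ⟨𝒰, hcard, hdiam, hsub⟩ := hcov r hr hr1
  refine le_trans ?_ hcard
  have hex : ∀ x : X, ∃ U : Set X, x ∈ S → U ∈ 𝒰 ∧ x ∈ U := fun x => by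
    by_cases hx : x ∈ S
    · obtain ⟨U, hU, hxU⟩ := Set.mem_iUnion₂.1 (hsub (hS x hx))
      exact ⟨U, fun _ => ⟨hU, hxU⟩⟩
    · exact ⟨∅, fun h => absurd h hx⟩
  choose f hf using hex
  have : S.card ≤ 𝒰.card := by
    refine Finset.card_le_card_of_injOn f (fun x hx => (hf x hx).1) ?_
    intro x hx y hy hxy
    by_contra hne
    have hb : Bornology.IsBounded (f x) :=
      Metric.isBounded_iff.2 ⟨1, fun a _ b _ => I.dist_le_one a b⟩
    have h1 := Metric.dist_le_diam_of_mem hb (hf x hx).2 (by rw [hxy]; exact (hf y hy).2)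
    have h2 := hdiam _ (hf x hx).1
    have h3 := hsep x hx y hy hne
    linarith
  exact_mod_cast this

/-- The infimum in the definition of the zooming dimension is attained: a minimal covering number
that is at most `C r ^ (-d')` for all `d' > d` is at most `C r ^ (-d)`. -/
lemma zoomingCovers_zoomingDim (I : LipschitzMAB X) {C : ℝ} (hC : 0 < C)
    (h : I.zoomingDim C ≠ ∞) : I.ZoomingCovers C (I.zoomingDim C).toReal := by
  intro r hr hr1
  classical
  have hlt : ∀ e : ℝ, (I.zoomingDim C).toReal < e → ∃ 𝒰 : Finset (Set X),
      (𝒰.card : ℝ) ≤ C * r ^ (-e) ∧ (∀ U ∈ 𝒰, Metric.diam U ≤ r / 8) ∧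
      I.nearOptimal r ⊆ ⋃ U ∈ 𝒰, U := by
    intro e he
    have h1 : I.zoomingDim C < ENNReal.ofReal e := (ENNReal.lt_ofReal_iff_toReal_lt h).2 he
    obtain ⟨d, hd⟩ := iInf_lt_iff.1 h1
    obtain ⟨hcov, hd⟩ := iInf_lt_iff.1 hd
    obtain ⟨𝒰, hcard, h2, h3⟩ := hcov r hr hr1
    refine ⟨𝒰, hcard.trans ?_, h2, h3⟩
    have hde : (d : ℝ) < e := by
      have := (ENNReal.lt_ofReal_iff_toReal_lt ENNReal.coe_ne_top).1 hd
      simpa using this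
    exact mul_le_mul_of_nonneg_left
      (Real.rpow_le_rpow_of_exponent_ge hr hr1 (by linarith)) hC.le
  have hN : ∃ N : ℕ, ∃ 𝒰 : Finset (Set X), 𝒰.card = N ∧
      (∀ U ∈ 𝒰, Metric.diam U ≤ r / 8) ∧ I.nearOptimal r ⊆ ⋃ U ∈ 𝒰, U := by
    obtain ⟨𝒰, -, h2, h3⟩ := hlt _ (lt_add_one _)
    exact ⟨_, 𝒰, rfl, h2, h3⟩
  obtain ⟨𝒰, hcard, h2, h3⟩ := Nat.find_spec hN
  refine ⟨𝒰, ?_, h2, h3⟩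
  have hcont : Filter.Tendsto (fun e : ℝ => C * r ^ (-e))
      (nhdsWithin (I.zoomingDim C).toReal (Set.Ioi (I.zoomingDim C).toReal))
      (nhds (C * r ^ (-(I.zoomingDim C).toReal))) := by
    have : Continuous fun e : ℝ => C * r ^ (-e) :=
      continuous_const.mul (continuous_const.rpow continuous_neg fun _ => Or.inl hr.ne')
    exact this.continuousAt.tendsto.mono_left nhdsWithin_le_nhds
  refine ge_of_tendsto hcont ?_
  filter_upwards [self_mem_nhdsWithin] with e he
  obtain ⟨𝒱, hc, hv2, hv3⟩ := hlt e he
  refine le_trans ?_ hc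
  rw [hcard]
  exact_mod_cast Nat.find_min' hN ⟨𝒱, rfl, hv2, hv3⟩

/-- Gaps in `(δ, 1/2]` of a finite set that is separated at every scale: the layers
`(δ 2^(j-1), δ 2^j]` contribute a geometric series. -/
lemma sum_inv_gap_le (I : LipschitzMAB X) {C d : ℝ} (hC : 0 < C) (hd : 0 ≤ d) (S : Finset X)
    (hcount : ∀ r : ℝ, 0 < r → r ≤ 1 → ∀ S' ⊆ S, (∀ x ∈ S', x ∈ I.nearOptimal r) →
      (S'.card : ℝ) ≤ C * r ^ (-d)) (J : ℕ) :
    ∀ δ : ℝ, 0 < δ → 1 / 2 ≤ δ * 2 ^ J →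
      ∑ x ∈ S with δ < I.gap x ∧ I.gap x ≤ 1 / 2, (I.gap x)⁻¹ ≤
        4 * C * (2 * δ) ^ (-(d + 1)) := by
  have hempty : ∀ δ : ℝ, 0 < δ → 1 / 2 ≤ δ →
      ∑ x ∈ S with δ < I.gap x ∧ I.gap x ≤ 1 / 2, (I.gap x)⁻¹ ≤
        4 * C * (2 * δ) ^ (-(d + 1)) := by
    intro δ hδ hδ2
    refine (Finset.sum_eq_zero fun x hx => ?_).trans_le (by positivity)
    have := (Finset.mem_filter.1 hx).2
    linarith [this.1, this.2]
  induction J with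
  | zero => exact fun δ hδ h => hempty δ hδ (by simpa using h)
  | succ J ih =>
    intro δ hδ h
    rcases le_or_gt (1 / 2) δ with h2 | h2
    · exact hempty δ hδ h2
    have hih := ih (2 * δ) (by positivity) (by rw [pow_succ] at h; linarith)
    have hsplit : ∑ x ∈ S with δ < I.gap x ∧ I.gap x ≤ 1 / 2, (I.gap x)⁻¹ ≤
        ∑ x ∈ S with δ < I.gap x ∧ I.gap x ≤ 2 * δ, (I.gap x)⁻¹ +
        ∑ x ∈ S with 2 * δ < I.gap x ∧ I.gap x ≤ 1 / 2, (I.gap x)⁻¹ := by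
      have hdisj : Disjoint (S.filter fun x => δ < I.gap x ∧ I.gap x ≤ 2 * δ)
          (S.filter fun x => 2 * δ < I.gap x ∧ I.gap x ≤ 1 / 2) :=
        Finset.disjoint_filter.2 fun x _ h1 h3 => h1.2.not_gt h3.1
      classical
      rw [← Finset.sum_union hdisj]
      refine Finset.sum_le_sum_of_subset_of_nonneg (fun x hx => ?_)
        fun x _ _ => inv_nonneg.2 (I.gap_nonneg x)
      simp only [Finset.mem_union, Finset.mem_filter] at hx ⊢
      rcases le_or_gt (I.gap x) (2 * δ) with h3 | h3
      · exact Or.inl ⟨hx.1, hx.2.1, h3⟩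
      · exact Or.inr ⟨hx.1, h3, hx.2.2⟩
    have hlayer : ∑ x ∈ S with δ < I.gap x ∧ I.gap x ≤ 2 * δ, (I.gap x)⁻¹ ≤
        2 * C * (2 * δ) ^ (-(d + 1)) := by
      have h1 := Finset.sum_le_card_nsmul (S.filter fun x => δ < I.gap x ∧ I.gap x ≤ 2 * δ)
        (fun x => (I.gap x)⁻¹) δ⁻¹ (fun x hx => by
          have := (Finset.mem_filter.1 hx).2.1
          exact inv_anti₀ hδ this.le)
      have h3 := hcount (2 * δ) (by positivity) (by linarith) _
        (Finset.filter_subset (fun x => δ < I.gap x ∧ I.gap x ≤ 2 * δ) S)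
        (fun x hx => by
          have := (Finset.mem_filter.1 hx).2
          exact ⟨by change _ < I.gap x; linarith [this.1], this.2⟩)
      rw [nsmul_eq_mul] at h1
      have h4 : (2 * δ) ^ (-(d + 1)) = (2 * δ) ^ (-d) * (2 * δ)⁻¹ := by
        rw [neg_add, Real.rpow_add (by positivity), Real.rpow_neg_one]
      calc _ ≤ _ := h1
        _ ≤ C * (2 * δ) ^ (-d) * δ⁻¹ := by gcongr
        _ = _ := by rw [h4, mul_inv]; ring
    have hgeo : (2 * (2 * δ)) ^ (-(d + 1)) ≤ 1 / 2 * (2 * δ) ^ (-(d + 1)) := by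
      rw [Real.mul_rpow (by norm_num) (by positivity)]
      gcongr
      calc (2 : ℝ) ^ (-(d + 1)) ≤ 2 ^ (-1 : ℝ) :=
            Real.rpow_le_rpow_of_exponent_le (by norm_num) (by linarith)
        _ = 1 / 2 := by rw [Real.rpow_neg_one]; norm_num
    have := mul_le_mul_of_nonneg_left hgeo (show 0 ≤ 4 * C by positivity)
    linarith

/-- The bound carries the factor `1 / (d + 2)`. For gaps at most `1 / 2` it comes from
`2 ^ (d + 1) ≥ d + 2`, for the larger ones from `(1 - δ) δ ^ (d + 1) ≤ 1 / (d + 2)`. -/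
lemma sum_excess_le (I : LipschitzMAB X) {C d : ℝ} (hC : 0 < C) (hd : 0 ≤ d) (S : Finset X)
    (hcount : ∀ r : ℝ, 0 < r → r ≤ 1 → ∀ S' ⊆ S, (∀ x ∈ S', x ∈ I.nearOptimal r) →
      (S'.card : ℝ) ≤ C * r ^ (-d)) {δ : ℝ} (hδ : 0 < δ) (hδ1 : δ ≤ 1) :
    ∑ x ∈ S with δ < I.gap x, (I.gap x - δ) / I.gap x ^ 2 ≤
      8 * C * (1 / (d + 2)) * δ ^ (-(d + 1)) := by
  have hsplit : ∑ x ∈ S with δ < I.gap x, (I.gap x - δ) / I.gap x ^ 2 ≤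
      ∑ x ∈ S with δ < I.gap x ∧ I.gap x ≤ 1 / 2, (I.gap x)⁻¹ +
      ∑ x ∈ S with δ < I.gap x ∧ 1 / 2 < I.gap x, 4 * (1 - δ) := by
    rw [← Finset.sum_filter_add_sum_filter_not (S.filter fun x => δ < I.gap x)
      (fun x => I.gap x ≤ 1 / 2), Finset.filter_filter, Finset.filter_filter]
    simp only [not_le]
    refine add_le_add (Finset.sum_le_sum fun x hx => ?_) (Finset.sum_le_sum fun x hx => ?_)
    · have h := (Finset.mem_filter.1 hx).2
      have hg : 0 < I.gap x := hδ.trans h.1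
      rw [div_le_iff₀ (by positivity), pow_two, inv_mul_cancel_left₀ hg.ne']
      linarith
    · have h := (Finset.mem_filter.1 hx).2
      have hg : 0 < I.gap x := hδ.trans h.1
      rw [div_le_iff₀ (by positivity)]
      have h1 := I.gap_le_one x
      have : 1 ≤ 4 * I.gap x ^ 2 := by nlinarith [h.2]
      nlinarith
  have htop : ∑ x ∈ S with δ < I.gap x ∧ 1 / 2 < I.gap x, 4 * (1 - δ) ≤
      4 * C * (1 / (d + 2)) * δ ^ (-(d + 1)) := by
    have h1 := hcount 1 one_pos le_rfl _
      (Finset.filter_subset (fun x => δ < I.gap x ∧ 1 / 2 < I.gap x) S)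
      (fun x hx => ⟨by change _ < I.gap x; linarith [(Finset.mem_filter.1 hx).2.2],
        I.gap_le_one x⟩)
    rw [Real.one_rpow, mul_one] at h1
    rw [Finset.sum_const, nsmul_eq_mul]
    have hb : (1 - δ) ≤ 1 / (d + 2) * δ ^ (-(d + 1)) := by
      have h2 := one_add_mul_self_le_rpow_one_add (s := δ⁻¹ - 1)
        (by have := (one_le_inv₀ hδ).2 hδ1; linarith) (p := d + 2) (by linarith)
      rw [add_sub_cancel, Real.inv_rpow hδ.le, ← Real.rpow_neg hδ.le] at h2
      have h3 : δ ^ (-(d + 1)) = δ ^ (-(d + 2)) * δ := by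
        rw [show -(d + 1) = -(d + 2) + 1 by ring, Real.rpow_add hδ, Real.rpow_one]
      have h4 := mul_le_mul_of_nonneg_right h2 hδ.le
      rw [← h3] at h4
      have h5 : (1 + (d + 2) * (δ⁻¹ - 1)) * δ = δ + (d + 2) * (1 - δ) := by field_simp
      rw [div_mul_eq_mul_div, le_div_iff₀ (by linarith)]
      linarith
    have h6 : 0 ≤ 4 * (1 - δ) := by linarith
    calc _ ≤ C * (4 * (1 - δ)) := by gcongr
      _ ≤ C * (4 * (1 / (d + 2) * δ ^ (-(d + 1)))) := by gcongr
      _ = _ := by ring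
  have hlow : ∑ x ∈ S with δ < I.gap x ∧ I.gap x ≤ 1 / 2, (I.gap x)⁻¹ ≤
      4 * C * (1 / (d + 2)) * δ ^ (-(d + 1)) := by
    obtain ⟨J, hJ⟩ := pow_unbounded_of_one_lt (1 / 2 / δ) (one_lt_two (α := ℝ))
    refine (I.sum_inv_gap_le hC hd S hcount J δ hδ ?_).trans ?_
    · rw [div_lt_iff₀ hδ] at hJ; linarith
    · rw [Real.mul_rpow (by norm_num) hδ.le, ← mul_assoc]
      gcongr
      have h2 := one_add_mul_self_le_rpow_one_add (s := 1) (by norm_num) (p := d + 1)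
        (by linarith)
      rw [Real.rpow_neg (by norm_num), ← one_div]
      refine one_div_le_one_div_of_le (by linarith) ?_
      norm_num at h2
      linarith
  linarith

end LipschitzMAB

/-! ### Clean rounds of the zooming algorithm -/

namespace Zooming

section Trace

variable {X : Type*}

lemma phase_eq_of_mem_Ico {i b s : ℕ} (hb : b + 2 ≤ 2 ^ (i + 1))
    (hs : s ∈ Finset.Ico (2 ^ i - 2) b) : phase s = i := by
  rw [Finset.mem_Ico] at hs
  exact Nat.log_eq_of_pow_le_of_lt_pow (by omega) (by omega)

lemma phaseStart_eq {i s : ℕ} (hs : phase s = i) : phaseStart s = 2 ^ i - 2 := by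
  rw [phaseStart, hs]

lemma phase_le {i s : ℕ} (hs : phase s = i) : 2 ^ i - 2 ≤ s ∧ s + 2 < 2 ^ (i + 1) := by
  subst hs
  have h1 := Nat.pow_log_le_self 2 (show s + 2 ≠ 0 by omega)
  have h2 := Nat.lt_pow_succ_log_self (b := 2) (by norm_num) (s + 2)
  exact ⟨by unfold phase; omega, h2⟩

lemma one_le_phase (s : ℕ) : 1 ≤ phase s := Nat.log_pos (by norm_num) (by omega)

lemma confRadius_pos (play : ℕ → X) (t : ℕ) (v : X) : 0 < confRadius play t v := by
  have : (1 : ℝ) ≤ phase t := by exact_mod_cast one_le_phase t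
  unfold confRadius
  positivity

lemma confRadius_sq (play : ℕ → X) (t : ℕ) (v : X) :
    confRadius play t v ^ 2 = 8 * (phase t : ℝ) / (2 + ((playsOf play t v).card : ℝ)) :=
  Real.sq_sqrt (by positivity)

/-- A strategy that has not been played in the current phase has a confidence radius above the
diameter of the space, so it covers everything. -/
lemma one_lt_confRadius {play : ℕ → X} {t : ℕ} {v : X} (h : playsOf play t v = ∅) :
    1 < confRadius play t v := by
  have : (1 : ℝ) ≤ phase t := by exact_mod_cast one_le_phase t
  rw [← one_lt_sq_iff₀ (confRadius_pos play t v).le, confRadius_sq, h]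
  norm_num
  linarith

variable {play : ℕ → X} {reward : ℕ → ℝ} {active : ℕ → Set X}

lemma activeBefore_succ {i s : ℕ} (hs : phase s = i) (hs' : phase (s + 1) = i) :
    activeBefore active (s + 1) = active s := by
  have := (phase_le hs).1
  rw [activeBefore, phaseStart_eq hs', if_neg (by omega), Nat.add_sub_cancel]

lemma mem_playsOf {t s : ℕ} {v : X} :
    s ∈ playsOf play t v ↔ phaseStart t ≤ s ∧ s < t ∧ play s = v := by
  simp [playsOf, and_assoc]

variable [MetricSpace X]

lemma IsTrace.activeBefore_subset (h : IsTrace play reward active) (s : ℕ) :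
    activeBefore active s ⊆ active s := by
  obtain ⟨⟨-, h1⟩ | ⟨u, -, h1⟩, -⟩ := h s
  · exact h1.ge
  · rw [h1]; exact Set.subset_insert _ _

lemma IsTrace.play_mem_activeBefore (h : IsTrace play reward active) {i s s' : ℕ}
    (hs : phase s = i) (hs' : phase s' = i) (hlt : s < s') :
    play s ∈ activeBefore active s' := by
  induction s', hlt using Nat.le_induction with
  | base => rw [activeBefore_succ hs hs']; exact (h s).2.1
  | succ k hk ih =>
    have hk' : phase k = i := by
      have h1 := (phase_le hs).1
      have h2 := (phase_le hs').2
      exact phase_eq_of_mem_Ico (b := k + 1) (by omega)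
        (Finset.mem_Ico.2 ⟨by omega, by omega⟩)
    rw [activeBefore_succ hk' hs']
    exact h.activeBefore_subset k (ih hk')

lemma IsTrace.mem_activeBefore (h : IsTrace play reward active) {t : ℕ} {v : X}
    (hv : (playsOf play t v).Nonempty) : v ∈ activeBefore active t := by
  obtain ⟨s, hs⟩ := hv
  obtain ⟨h1, h2, rfl⟩ := mem_playsOf.1 hs
  refine h.play_mem_activeBefore (i := phase t) ?_ rfl h2
  have h3 := (phase_le (s := t) rfl).2
  exact phase_eq_of_mem_Ico (b := t) (by omega) (Finset.mem_Ico.2 ⟨h1, h2⟩)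

/-- One activation per round suffices to cover the whole space. -/
lemma IsTrace.covered (h : IsTrace play reward active) (I : LipschitzMAB X) (t : ℕ) (u : X) :
    ∃ v ∈ active t, dist u v < confRadius play t v := by
  obtain ⟨⟨h1, h2⟩ | ⟨w, h1, h2⟩, -⟩ := h t
  · obtain ⟨v, hv, hu⟩ := h1 u
    exact ⟨v, h2 ▸ hv, hu⟩
  · refine ⟨w, h2 ▸ Set.mem_insert _ _, (I.dist_le_one u w).trans_lt (one_lt_confRadius ?_)⟩
    by_contra hne
    exact h1 ⟨w, h.mem_activeBefore (Finset.nonempty_iff_ne_empty.2 hne),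
      Metric.mem_ball_self (confRadius_pos _ _ _)⟩

/-- In round `t` all average rewards are within the confidence radius of the expectations. -/
def Clean (I : LipschitzMAB X) (play : ℕ → X) (reward : ℕ → ℝ) (t : ℕ) : Prop :=
  ∀ v, |avgReward play reward t v - I.μ v| ≤ confRadius play t v

/-- The played strategy has the largest index, and every strategy `u` is covered by an active one
whose index is at least `μ(u)`. -/
lemma IsTrace.gap_le (h : IsTrace play reward active) {I : LipschitzMAB X} {t : ℕ}
    (hc : Clean I play reward t) : I.gap (play t) ≤ 3 * confRadius play t (play t) := by
  refine I.gap_le_of_forall _ fun u => ?_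
  obtain ⟨v, hv, huv⟩ := h.covered I t u
  have h1 := (h t).2.2 v hv
  have h2 := abs_le.1 (hc v)
  have h3 := abs_le.1 (hc (play t))
  have h4 := (abs_le.1 (I.lipschitz u v)).2
  unfold ucbIndex at h1
  linarith [h2.1, h3.2]

open Classical in
/-- The last play of `v` took place when the confidence radius was still at least a third of the
gap of `v`. -/
lemma IsTrace.card_mul_gap_sq_le (h : IsTrace play reward active) {I : LipschitzMAB X} {i b : ℕ}
    (hb : b + 2 ≤ 2 ^ (i + 1)) (hc : ∀ s ∈ Finset.Ico (2 ^ i - 2) b, Clean I play reward s)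
    {v : X} (hv : ((Finset.Ico (2 ^ i - 2) b).filter fun s => play s = v).Nonempty) :
    ((((Finset.Ico (2 ^ i - 2) b).filter fun s => play s = v).card : ℝ) + 1) * I.gap v ^ 2 ≤
      72 * i := by
  obtain ⟨s, hs, hmax⟩ : ∃ s ∈ (Finset.Ico (2 ^ i - 2) b).filter fun s => play s = v,
      ∀ s' ∈ (Finset.Ico (2 ^ i - 2) b).filter fun s => play s = v, s' ≤ s :=
    ⟨_, Finset.max'_mem _ hv, fun s' hs' => Finset.le_max' _ _ hs'⟩
  have hsI := (Finset.mem_filter.1 hs).1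
  have hph := phase_eq_of_mem_Ico hb hsI
  have hsv := (Finset.mem_filter.1 hs).2
  have hcard : ((Finset.Ico (2 ^ i - 2) b).filter fun s => play s = v).card =
      (playsOf play s v).card + 1 := by
    rw [← Finset.card_erase_add_one hs]
    congr 2
    ext s'
    rw [mem_playsOf, Finset.mem_erase, phaseStart_eq hph]
    rw [Finset.mem_Ico] at hsI
    constructor
    · rintro ⟨h1, h2⟩
      have := hmax s' h2
      simp only [Finset.mem_filter, Finset.mem_Ico] at h2
      exact ⟨h2.1.1, by omega, h2.2⟩
    · rintro ⟨h1, h2, h3⟩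
      exact ⟨by omega, Finset.mem_filter.2 ⟨Finset.mem_Ico.2 ⟨h1, by omega⟩, h3⟩⟩
  have h1 := h.gap_le (hc s hsI)
  rw [hsv] at h1
  have h2 : I.gap v ^ 2 ≤ (3 * confRadius play s v) ^ 2 :=
    pow_le_pow_left₀ (I.gap_nonneg v) h1 2
  rw [mul_pow, confRadius_sq, hph, ← mul_div_assoc, le_div_iff₀ (by positivity)] at h2
  rw [hcard]
  push_cast
  linarith

/-- The confidence radius never drops much below a third of the gap, since a strategy with a small
radius is no longer played. -/
lemma IsTrace.gap_sq_le_confRadius_sq (h : IsTrace play reward active) {I : LipschitzMAB X}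
    {i s : ℕ} (hs : phase s = i) (hc : ∀ s' ∈ Finset.Ico (2 ^ i - 2) s, Clean I play reward s')
    (v : X) : 2 / 27 * I.gap v ^ 2 ≤ confRadius play s v ^ 2 := by
  classical
  rcases (playsOf play s v).eq_empty_or_nonempty with h0 | h0
  · have h1 := one_lt_confRadius h0
    have h2 := I.gap_le_one v
    have h3 := I.gap_nonneg v
    nlinarith
  · have heq : playsOf play s v = (Finset.Ico (2 ^ i - 2) s).filter fun s => play s = v := by
      rw [playsOf, phaseStart_eq hs]
    have hb := (phase_le hs).2
    have h1 := h.card_mul_gap_sq_le hb.le hc (heq ▸ h0)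
    rw [confRadius_sq, hs, le_div_iff₀ (by positivity)]
    rw [← heq] at h1
    have h2 : (1 : ℝ) ≤ (playsOf play s v).card := by exact_mod_cast h0.card_pos
    have h3 := sq_nonneg (I.gap v)
    nlinarith

/-- A strategy is activated only outside the confidence balls of the active ones, so the active
strategies with comparable gaps are separated. -/
lemma IsTrace.dist_sq_ge (h : IsTrace play reward active) {I : LipschitzMAB X} {i b : ℕ}
    (hb : b + 2 ≤ 2 ^ (i + 1)) (hc : ∀ s ∈ Finset.Ico (2 ^ i - 2) b, Clean I play reward s)
    {s : ℕ} (hs : s ∈ Finset.Ico (2 ^ i - 2) b) {u v : X} (hu : u ∈ active s) (hv : v ∈ active s)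
    (huv : u ≠ v) : 2 / 27 * (min (I.gap u) (I.gap v)) ^ 2 ≤ dist u v ^ 2 := by
  have hstep : ∀ s ∈ Finset.Ico (2 ^ i - 2) b,
      (∀ u ∈ activeBefore active s, ∀ v ∈ activeBefore active s, u ≠ v →
        2 / 27 * (min (I.gap u) (I.gap v)) ^ 2 ≤ dist u v ^ 2) →
      ∀ u ∈ active s, ∀ v ∈ active s, u ≠ v →
        2 / 27 * (min (I.gap u) (I.gap v)) ^ 2 ≤ dist u v ^ 2 := by
    intro s hs hpre
    obtain ⟨⟨-, h1⟩ | ⟨w, h1, h1'⟩, -⟩ := h s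
    · rwa [h1]
    have hnew : ∀ u ∈ activeBefore active s,
        2 / 27 * I.gap u ^ 2 ≤ dist w u ^ 2 := by
      intro u hu
      have h2 : confRadius play s u ≤ dist w u := by
        by_contra! hlt
        exact h1 ⟨u, hu, hlt⟩
      refine (h.gap_sq_le_confRadius_sq (phase_eq_of_mem_Ico hb hs) (fun s' hs' => hc s' ?_)
        u).trans (pow_le_pow_left₀ (confRadius_pos _ _ _).le h2 2)
      rw [Finset.mem_Ico] at hs hs' ⊢
      omega
    have hmin : ∀ u v : X, (min (I.gap u) (I.gap v)) ^ 2 ≤ I.gap u ^ 2 ∧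
        (min (I.gap u) (I.gap v)) ^ 2 ≤ I.gap v ^ 2 := fun u v =>
      have h0 := le_min (I.gap_nonneg u) (I.gap_nonneg v)
      ⟨pow_le_pow_left₀ h0 (min_le_left _ _) 2, pow_le_pow_left₀ h0 (min_le_right _ _) 2⟩
    rw [h1']
    rintro u (rfl | hu) v (rfl | hv) huv
    · exact absurd rfl huv
    · linarith [hnew v hv, (hmin u v).2]
    · rw [dist_comm]
      linarith [hnew u hu, (hmin u v).1]
    · exact hpre u hu v hv huv
  have hall : ∀ s, 2 ^ i - 2 ≤ s → s < b → ∀ u ∈ active s, ∀ v ∈ active s, u ≠ v →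
      2 / 27 * (min (I.gap u) (I.gap v)) ^ 2 ≤ dist u v ^ 2 := by
    intro s hs
    induction s, hs using Nat.le_induction with
    | base =>
      intro hsb
      have hmem := Finset.mem_Ico.2 ⟨le_rfl, hsb⟩
      refine hstep _ hmem ?_
      rw [activeBefore, phaseStart_eq (phase_eq_of_mem_Ico hb hmem), if_pos rfl]
      simp
    | succ k hk ih =>
      intro hsb
      have hmem : k + 1 ∈ Finset.Ico (2 ^ i - 2) b := Finset.mem_Ico.2 ⟨by omega, hsb⟩
      have hmem' : k ∈ Finset.Ico (2 ^ i - 2) b := Finset.mem_Ico.2 ⟨by omega, by omega⟩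
      refine hstep _ hmem ?_
      rw [activeBefore_succ (phase_eq_of_mem_Ico hb hmem') (phase_eq_of_mem_Ico hb hmem)]
      exact ih (by omega)
  rw [Finset.mem_Ico] at hs
  exact hall s hs.1 hs.2 u hu v hv huv

/-- The regret above the level `δ` that clean rounds of one phase incur. -/
lemma IsTrace.sum_excess_le (h : IsTrace play reward active) {I : LipschitzMAB X} {i b : ℕ}
    (hb : b + 2 ≤ 2 ^ (i + 1)) (hc : ∀ s ∈ Finset.Ico (2 ^ i - 2) b, Clean I play reward s)
    {C d : ℝ} (hC : 0 < C) (hd : 0 ≤ d) (hcov : I.ZoomingCovers C d)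
    {δ : ℝ} (hδ : 0 < δ) (hδ1 : δ ≤ 1) :
    ∑ s ∈ Finset.Ico (2 ^ i - 2) b, max (I.gap (play s) - δ) 0 ≤
      576 * i * C * (1 / (d + 2)) * δ ^ (-(d + 1)) := by
  classical
  set S := (Finset.Ico (2 ^ i - 2) b).image play with hS
  have hcount : ∀ r : ℝ, 0 < r → r ≤ 1 → ∀ S' ⊆ S, (∀ x ∈ S', x ∈ I.nearOptimal r) →
      (S'.card : ℝ) ≤ C * r ^ (-d) := by
    intro r hr hr1 S' hS' hnear
    refine hcov.card_le hr hr1 S' hnear fun x hx y hy hxy => ?_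
    obtain ⟨s, hs, rfl⟩ := Finset.mem_image.1 (hS' hx)
    obtain ⟨s', hs', rfl⟩ := Finset.mem_image.1 (hS' hy)
    have hact : ∀ k k' : ℕ, k ∈ Finset.Ico (2 ^ i - 2) b → k' ∈ Finset.Ico (2 ^ i - 2) b →
        k ≤ k' → play k ∈ active k' := by
      intro k k' hk hk' hle
      rcases hle.eq_or_lt with rfl | hlt
      · exact (h k).2.1
      · exact h.activeBefore_subset _ (h.play_mem_activeBefore
          (phase_eq_of_mem_Ico hb hk) (phase_eq_of_mem_Ico hb hk') hlt)
    have hmax : max s s' ∈ Finset.Ico (2 ^ i - 2) b := by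
      rcases max_choice s s' with h1 | h1 <;> rw [h1] <;> assumption
    have h1 := h.dist_sq_ge hb hc hmax (hact _ _ hs hmax (le_max_left _ _))
      (hact _ _ hs' hmax (le_max_right _ _)) hxy
    have h2 : r / 2 < min (I.gap (play s)) (I.gap (play s')) :=
      lt_min (hnear _ hx).1 (hnear _ hy).1
    by_contra! hle
    have h3 : dist (play s) (play s') ^ 2 ≤ (r / 8) ^ 2 := pow_le_pow_left₀ dist_nonneg hle 2
    nlinarith
  have hfib : ∑ s ∈ Finset.Ico (2 ^ i - 2) b, max (I.gap (play s) - δ) 0 =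
      ∑ x ∈ S, ((Finset.Ico (2 ^ i - 2) b).filter fun s => play s = x).card *
        max (I.gap x - δ) 0 := by
    rw [← Finset.sum_fiberwise_of_maps_to (t := S) (g := play)
      (fun s hs => Finset.mem_image_of_mem _ hs)]
    refine Finset.sum_congr rfl fun x _ => ?_
    rw [Finset.sum_congr rfl (g := fun _ => max (I.gap x - δ) 0)
      (fun s hs => by rw [(Finset.mem_filter.1 hs).2]), Finset.sum_const, nsmul_eq_mul]
  have hle : ∑ x ∈ S, (((Finset.Ico (2 ^ i - 2) b).filter fun s => play s = x).card : ℝ) *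
        max (I.gap x - δ) 0 ≤
      72 * i * ∑ x ∈ S with δ < I.gap x, (I.gap x - δ) / I.gap x ^ 2 := by
    rw [Finset.mul_sum, Finset.sum_filter]
    refine Finset.sum_le_sum fun x hx => ?_
    split_ifs with hg
    · rw [max_eq_left (by linarith)]
      have hgp : 0 < I.gap x := hδ.trans hg
      obtain ⟨s, hs, hsx⟩ := Finset.mem_image.1 hx
      have h1 := h.card_mul_gap_sq_le hb hc (v := x) ⟨s, Finset.mem_filter.2 ⟨hs, hsx⟩⟩
      rw [← mul_div_assoc, le_div_iff₀ (by positivity)]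
      have h2 : (((Finset.Ico (2 ^ i - 2) b).filter fun s => play s = x).card : ℝ) *
          I.gap x ^ 2 ≤ 72 * i := by nlinarith [sq_nonneg (I.gap x)]
      nlinarith
    · rw [max_eq_right (by linarith)]
      simp
  rw [hfib]
  refine hle.trans ?_
  have := mul_le_mul_of_nonneg_left (I.sum_excess_le hC hd S hcount hδ hδ1)
    (show (0 : ℝ) ≤ 72 * i by positivity)
  linarith

end Trace

end Zooming

/-! ### Concentration of the average rewards -/

namespace Zooming

noncomputable section

/-- Truncation of a payoff to `[0, 1]`. Payoffs are almost surely unchanged, and bounded functions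
of them become available to the law of the rewards. -/
def clamp (y : ℝ) : ℝ := max 0 (min 1 y)

lemma clamp_mem_Icc (y : ℝ) : clamp y ∈ Set.Icc (0 : ℝ) 1 :=
  ⟨le_max_left _ _, max_le zero_le_one (min_le_left _ _)⟩

lemma clamp_of_mem {y : ℝ} (h : y ∈ Set.Icc (0 : ℝ) 1) : clamp y = y := by
  rw [clamp, min_eq_right h.2, max_eq_right h.1]

lemma measurable_clamp : Measurable clamp := by
  unfold clamp; fun_prop

section Payoff

variable {X : Type*} [MetricSpace X] (I : LipschitzMAB X)

lemma integral_clamp_payoff (x : X) : ∫ y, clamp y ∂(I.payoff x) = I.μ x := by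
  rw [← I.mean_payoff x]
  refine integral_congr_ae ?_
  filter_upwards [I.support_payoff x] with y hy using clamp_of_mem hy

/-- Hoeffding's lemma for the payoff distributions. -/
lemma integral_exp_clamp_payoff_le (x : X) (l : ℝ) :
    ∫ y, Real.exp (l * clamp y) ∂(I.payoff x) ≤ Real.exp (l * I.μ x + l ^ 2 / 8) := by
  have := I.isProbabilityMeasure_payoff x
  have h := (hasSubgaussianMGF_of_mem_Icc (μ := I.payoff x) (X := clamp)
    measurable_clamp.aemeasurable (Filter.Eventually.of_forall clamp_mem_Icc)).mgf_le l
  rw [integral_clamp_payoff, mgf] at h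
  have h1 : ∫ y, Real.exp (l * clamp y) ∂(I.payoff x) =
      Real.exp (l * I.μ x) * ∫ y, Real.exp (l * (clamp y - I.μ x)) ∂(I.payoff x) := by
    rw [← integral_const_mul]
    refine integral_congr_ae (Filter.Eventually.of_forall fun y => ?_)
    change Real.exp _ = Real.exp _ * Real.exp _
    rw [← Real.exp_add]
    congr 1; ring
  rw [h1, Real.exp_add]
  refine mul_le_mul_of_nonneg_left (h.trans (le_of_eq ?_)) (Real.exp_pos _).le
  congr 1
  norm_num
  ring

end Payoff

section Probability

variable {X : Type*} [MetricSpace X] {I : LipschitzMAB X} {Ω : Type*} [mΩ : MeasurableSpace Ω]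
  {P : Measure Ω}

namespace Run

variable (A : Run I P)

lemma measurable_reward (t : ℕ) : Measurable (A.reward t) :=
  (A.reward_measurable t).mono (A.history.le _) le_rfl

lemma stronglyMeasurable_μ_play (t : ℕ) :
    StronglyMeasurable[A.history t] fun ω => I.μ (A.play t ω) :=
  I.continuous_μ.comp_stronglyMeasurable (A.play_measurable t)

open Classical in
/-- The factor of round `s` in the exponential supermartingale with parameter `l` that follows the
strategy played in round `s₀`. -/
def tilt (s₀ : ℕ) (l : ℝ) (s : ℕ) (ω : Ω) : ℝ :=
  if A.play s ω = A.play s₀ ω then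
    Real.exp (l * (clamp (A.reward s ω) - I.μ (A.play s ω)) - l ^ 2 / 8) else 1

/-- The exponential supermartingale `exp (l M - l² N / 8)`, where `N` is the number of plays in
rounds `s₀, …, t - 1` of the strategy played in round `s₀`, and `M` the sum of their centred
rewards. -/
def expMart (s₀ : ℕ) (l : ℝ) (t : ℕ) (ω : Ω) : ℝ := ∏ s ∈ Finset.Ico s₀ t, A.tilt s₀ l s ω

lemma tilt_nonneg (s₀ : ℕ) (l : ℝ) (s : ℕ) (ω : Ω) : 0 ≤ A.tilt s₀ l s ω := by
  unfold tilt; split_ifs <;> positivity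

lemma tilt_le (s₀ : ℕ) (l : ℝ) (s : ℕ) (ω : Ω) : A.tilt s₀ l s ω ≤ Real.exp |l| := by
  unfold tilt
  split_ifs
  · refine Real.exp_le_exp.2 ?_
    have h1 := clamp_mem_Icc (A.reward s ω)
    have h2 := I.μ_mem_Icc (A.play s ω)
    have h3 : |clamp (A.reward s ω) - I.μ (A.play s ω)| ≤ 1 :=
      abs_le.2 ⟨by linarith [h1.1, h2.2], by linarith [h1.2, h2.1]⟩
    have h4 := le_abs_self (l * (clamp (A.reward s ω) - I.μ (A.play s ω)))
    rw [abs_mul] at h4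
    nlinarith [abs_nonneg l, sq_nonneg l]
  · exact Real.one_le_exp (abs_nonneg l)

lemma measurableSet_play_eq {s₀ s : ℕ} (h : s₀ ≤ s) :
    MeasurableSet[A.history s] {ω | A.play s ω = A.play s₀ ω} :=
  (A.play_measurable s).measurableSet_eq_fun
    ((A.play_measurable s₀).mono (A.history.mono h))

lemma measurable_tilt {s₀ s : ℕ} (h : s₀ ≤ s) (l : ℝ) :
    Measurable[A.history (s + 1)] (A.tilt s₀ l s) := by
  classical
  have hle := A.history.mono (Nat.le_succ s)
  refine Measurable.ite (hle _ (A.measurableSet_play_eq h)) ?_ measurable_const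
  have h1 : Measurable[A.history (s + 1)] fun ω => clamp (A.reward s ω) :=
    measurable_clamp.comp (A.reward_measurable s)
  have h2 : Measurable[A.history (s + 1)] fun ω => I.μ (A.play s ω) :=
    ((A.stronglyMeasurable_μ_play s).mono hle).measurable
  exact Real.measurable_exp.comp (((h1.sub h2).const_mul l).sub_const _)

lemma measurable_expMart (s₀ t : ℕ) (l : ℝ) : Measurable[A.history t] (A.expMart s₀ l t) := by
  refine Finset.measurable_fun_prod _ fun s hs => ?_
  rw [Finset.mem_Ico] at hs
  exact (A.measurable_tilt hs.1 l).mono (A.history.mono hs.2) le_rfl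

lemma expMart_nonneg (s₀ t : ℕ) (l : ℝ) (ω : Ω) : 0 ≤ A.expMart s₀ l t ω :=
  Finset.prod_nonneg fun _ _ => A.tilt_nonneg _ _ _ _

lemma expMart_le (s₀ t : ℕ) (l : ℝ) (ω : Ω) :
    A.expMart s₀ l t ω ≤ Real.exp |l| ^ (Finset.Ico s₀ t).card :=
  (Finset.prod_le_prod (fun _ _ => A.tilt_nonneg _ _ _ _) fun _ _ => A.tilt_le _ _ _ _).trans_eq
    (Finset.prod_const _)

lemma expMart_eq (s₀ t : ℕ) (l : ℝ) {ω : Ω} (hω : ∀ s, A.reward s ω ∈ Set.Icc (0 : ℝ) 1)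
    {F : Finset ℕ} (hF : ∀ s, s ∈ F ↔ s ∈ Finset.Ico s₀ t ∧ A.play s ω = A.play s₀ ω) :
    A.expMart s₀ l t ω = Real.exp (l * (∑ s ∈ F, A.reward s ω - F.card * I.μ (A.play s₀ ω)) -
      F.card * (l ^ 2 / 8)) := by
  classical
  have hF' : F = (Finset.Ico s₀ t).filter fun s => A.play s ω = A.play s₀ ω := by
    ext s; rw [hF, Finset.mem_filter]
  have h1 : A.expMart s₀ l t ω = ∏ s ∈ F,
      Real.exp (l * (A.reward s ω - I.μ (A.play s₀ ω)) - l ^ 2 / 8) := by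
    rw [hF', Finset.prod_filter]
    refine Finset.prod_congr rfl fun s _ => ?_
    unfold tilt
    rw [clamp_of_mem (hω s)]
    by_cases h : A.play s ω = A.play s₀ ω
    · rw [if_pos h, if_pos h, h]
    · rw [if_neg h, if_neg h]
  rw [h1, ← Real.exp_sum, Finset.sum_sub_distrib, ← Finset.mul_sum, Finset.sum_sub_distrib]
  simp

lemma stronglyMeasurable_gap_play (t : ℕ) : StronglyMeasurable fun ω => I.gap (A.play t ω) :=
  stronglyMeasurable_const.sub ((A.stronglyMeasurable_μ_play t).mono (A.history.le t))

/-- The event that some supermartingale of phase `i` gets large. The parameter is optimal for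
exactly `n` plays, so one supermartingale is used for every `n` and both signs. -/
def badEvent (i b : ℕ) : Set Ω :=
  ⋃ p ∈ (Finset.Ico (2 ^ i - 2) b ×ˢ Finset.Ico (2 ^ i - 2) b) ×ˢ
      (Finset.Icc 1 (2 ^ i) ×ˢ ({1, -1} : Finset ℝ)),
    {ω | Real.exp (16 * i / 3) ≤
      A.expMart p.1.1 (p.2.2 * (4 * √(8 * i / (2 + (p.2.1 : ℕ))))) p.1.2 ω}

lemma measurableSet_badEvent (i b : ℕ) : MeasurableSet (A.badEvent i b) :=
  Finset.measurableSet_biUnion _ fun p _ =>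
    measurableSet_le measurable_const
      ((A.measurable_expMart p.1.1 p.1.2 _).mono (A.history.le _) le_rfl)

/-- Outside the bad event, an average over `n` plays deviates by at most the confidence radius:
the supermartingale that starts at the first play would exceed its bound otherwise. -/
lemma clean_of_notMem_badEvent {i b : ℕ} (hb : b + 2 ≤ 2 ^ (i + 1)) (hi : 1 ≤ i)
    {ω : Ω} (hω : ∀ s, A.reward s ω ∈ Set.Icc (0 : ℝ) 1) (hbad : ω ∉ A.badEvent i b)
    {t : ℕ} (ht : t ∈ Finset.Ico (2 ^ i - 2) b) :
    Clean I (fun s => A.play s ω) (fun s => A.reward s ω) t := by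
  intro v
  have hph := phase_eq_of_mem_Ico hb ht
  set F := playsOf (fun s => A.play s ω) t v with hFdef
  rcases F.eq_empty_or_nonempty with h0 | h0
  · have h1 := one_lt_confRadius (play := fun s => A.play s ω) (t := t) (v := v) h0
    have h2 := I.μ_mem_Icc v
    rw [avgReward, ← hFdef, h0]
    simp only [Finset.sum_empty, Finset.card_empty, zero_div, Nat.cast_zero, zero_sub, abs_neg]
    rw [abs_of_nonneg h2.1]
    linarith [h2.2]
  obtain ⟨s₀, hs₀, hmin⟩ : ∃ s₀ ∈ F, ∀ s ∈ F, s₀ ≤ s :=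
    ⟨_, Finset.min'_mem _ h0, fun s hs => Finset.min'_le _ _ hs⟩
  obtain ⟨h1, h2, h3⟩ := mem_playsOf.1 hs₀
  rw [phaseStart_eq hph] at h1
  have hF : ∀ s, s ∈ F ↔ s ∈ Finset.Ico s₀ t ∧ A.play s ω = A.play s₀ ω := by
    intro s
    rw [Finset.mem_Ico]
    constructor
    · intro hs
      obtain ⟨h4, h5, h6⟩ := mem_playsOf.1 hs
      exact ⟨⟨hmin s hs, h5⟩, h6.trans h3.symm⟩
    · rintro ⟨⟨h4, h5⟩, h6⟩
      exact mem_playsOf.2 ⟨by rw [phaseStart_eq hph]; omega, h5, h6.trans h3⟩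
  have ht' := Finset.mem_Ico.1 ht
  have hn1 : 1 ≤ F.card := h0.card_pos
  have hn2 : F.card ≤ 2 ^ i := by
    have h4 : F ⊆ Finset.Ico (2 ^ i - 2) t := fun s hs => by
      have := (Finset.mem_Ico.1 ((hF s).1 hs).1)
      exact Finset.mem_Ico.2 ⟨by omega, this.2⟩
    have h5 := Finset.card_le_card h4
    rw [Nat.card_Ico] at h5
    rw [pow_succ] at hb
    omega
  set n := F.card with hn
  have hnR : (1 : ℝ) ≤ n := by exact_mod_cast hn1
  have hiR : (1 : ℝ) ≤ i := by exact_mod_cast hi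
  have hrad : confRadius (fun s => A.play s ω) t v = √(8 * i / (2 + n)) := by
    rw [confRadius, hph]
  set r := √(8 * i / (2 + n)) with hr
  have hr0 : 0 < r := Real.sqrt_pos.2 (by positivity)
  have hr2 : r ^ 2 * (2 + n) = 8 * i := by
    rw [hr, Real.sq_sqrt (by positivity)]; field_simp
  have hnr : 16 * (i : ℝ) / 3 ≤ 2 * n * r ^ 2 := by nlinarith [sq_nonneg r]
  -- a deviation above `r` makes the supermartingale with parameter `σ * 4 r` large
  have key : ∀ σ ∈ ({1, -1} : Finset ℝ), σ ^ 2 = 1 →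
      σ * (∑ s ∈ F, A.reward s ω - n * I.μ v) ≤ n * r := by
    intro σ hσ hσ2
    by_contra! hlt
    refine hbad (Set.mem_iUnion₂.2 ⟨((s₀, t), (n, σ)), ?_, ?_⟩)
    · simp only [Finset.mem_product, Finset.mem_Icc]
      exact ⟨⟨Finset.mem_Ico.2 ⟨h1, by omega⟩, ht⟩, ⟨hn1, hn2⟩, hσ⟩
    · change Real.exp _ ≤ A.expMart s₀ (σ * (4 * r)) t ω
      rw [A.expMart_eq s₀ t _ hω hF, Real.exp_le_exp, h3, ← hn]
      have h7 : (σ * (4 * r)) ^ 2 = 16 * r ^ 2 := by rw [mul_pow, hσ2]; ring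
      rw [h7]
      nlinarith
  rw [hrad, avgReward, ← hFdef, ← hn]
  have hsub : (∑ s ∈ F, A.reward s ω) / (n : ℝ) - I.μ v =
      (∑ s ∈ F, A.reward s ω - n * I.μ v) / n := by field_simp
  rw [hsub, abs_div, abs_of_pos (show (0 : ℝ) < n by linarith), div_le_iff₀ (by linarith)]
  refine abs_le.2 ⟨?_, ?_⟩
  · have := key (-1) (by simp) (by norm_num); linarith
  · have := key 1 (by simp) (by norm_num); linarith

variable [IsProbabilityMeasure P]

lemma integrable_comp_reward (t : ℕ) {f : ℝ → ℝ} (hf : Measurable f) {M : ℝ}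
    (hM : ∀ y, |f y| ≤ M) : Integrable (fun ω => f (A.reward t ω)) P :=
  Integrable.of_bound (hf.comp (A.measurable_reward t)).aestronglyMeasurable M
    (Filter.Eventually.of_forall fun _ => hM _)

lemma integral_comp_reward (t : ℕ) {f : ℝ → ℝ} (hf : Measurable f) {M : ℝ}
    (hM : ∀ y, |f y| ≤ M) :
    ∫ ω, f (A.reward t ω) ∂P = ∫ ω, (∫ y, f y ∂(I.payoff (A.play t ω))) ∂P := by
  rw [← integral_condExp (A.history.le t)]
  exact integral_congr_ae (A.reward_law t f hf ⟨M, hM⟩)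

lemma reward_mem_Icc : ∀ᵐ ω ∂P, ∀ t, A.reward t ω ∈ Set.Icc (0 : ℝ) 1 := by
  refine ae_all_iff.2 fun t => ?_
  set f : ℝ → ℝ := (Set.Icc (0 : ℝ) 1)ᶜ.indicator 1 with hf
  have hfm : Measurable f := measurable_one.indicator measurableSet_Icc.compl
  have hfb : ∀ y, |f y| ≤ 1 := fun y => by
    by_cases hy : y ∈ (Set.Icc (0 : ℝ) 1)ᶜ <;> simp [hf, hy]
  have h0 : ∫ ω, f (A.reward t ω) ∂P = 0 := by
    rw [A.integral_comp_reward t hfm hfb]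
    refine integral_eq_zero_of_ae (Filter.Eventually.of_forall fun ω => ?_)
    refine integral_eq_zero_of_ae ?_
    filter_upwards [I.support_payoff (A.play t ω)] with y hy
    exact Set.indicator_of_notMem (by simpa using hy) _
  rw [integral_eq_zero_iff_of_nonneg
    (show 0 ≤ fun ω => f (A.reward t ω) from
      fun ω => Set.indicator_nonneg (fun _ _ => zero_le_one) _)
    (A.integrable_comp_reward t hfm hfb)] at h0
  filter_upwards [h0] with ω hω
  by_contra hn
  have : f (A.reward t ω) = 1 := Set.indicator_of_mem (Set.mem_compl hn) _
  rw [show f (A.reward t ω) = 0 from hω] at this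
  exact zero_ne_one this

lemma integrable_reward (t : ℕ) : Integrable (A.reward t) P :=
  Integrable.of_bound (A.measurable_reward t).aestronglyMeasurable 1 <| by
    filter_upwards [A.reward_mem_Icc] with ω hω
    rw [Real.norm_of_nonneg (hω t).1]
    exact (hω t).2

lemma integral_reward (t : ℕ) : ∫ ω, A.reward t ω ∂P = ∫ ω, I.μ (A.play t ω) ∂P := by
  have h1 : ∫ ω, A.reward t ω ∂P = ∫ ω, clamp (A.reward t ω) ∂P := by
    refine integral_congr_ae ?_
    filter_upwards [A.reward_mem_Icc] with ω hω using (clamp_of_mem (hω t)).symm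
  rw [h1, A.integral_comp_reward t measurable_clamp (M := 1) fun y => by
    rw [abs_of_nonneg (clamp_mem_Icc y).1]; exact (clamp_mem_Icc y).2]
  simp_rw [integral_clamp_payoff]

lemma integrable_gap_play (t : ℕ) : Integrable (fun ω => I.gap (A.play t ω)) P :=
  Integrable.of_bound (A.stronglyMeasurable_gap_play t).aestronglyMeasurable 1 <|
    Filter.Eventually.of_forall fun ω => by
      rw [Real.norm_of_nonneg (I.gap_nonneg _)]; exact I.gap_le_one _

lemma regret_eq_sum_integral_gap (t : ℕ) :
    A.regret t = ∑ s ∈ Finset.range t, ∫ ω, I.gap (A.play s ω) ∂P := by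
  have hμ : ∀ s, Integrable (fun ω => I.μ (A.play s ω)) P := fun s =>
    Integrable.of_bound ((A.stronglyMeasurable_μ_play s).mono
      (A.history.le s)).aestronglyMeasurable 1 <| Filter.Eventually.of_forall fun ω => by
        rw [Real.norm_of_nonneg (I.μ_mem_Icc _).1]; exact (I.μ_mem_Icc _).2
  rw [regret, integral_finsetSum _ fun s _ => A.integrable_reward s]
  have : ∀ s, ∫ ω, I.gap (A.play s ω) ∂P = I.maxReward - ∫ ω, A.reward s ω ∂P := fun s => by
    rw [A.integral_reward s]
    unfold LipschitzMAB.gap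
    rw [integral_sub (integrable_const _) (hμ s)]
    simp
  simp [this]

/-- One step of the supermartingale argument: given the past, a reward may be replaced by any
bound on the conditional expectation. -/
lemma integral_mul_comp_reward_le (t : ℕ) {f : ℝ → ℝ} (hf : Measurable f) {M : ℝ}
    (hM : ∀ y, |f y| ≤ M) {Z g : Ω → ℝ} (hZ : StronglyMeasurable[A.history t] Z) {M' : ℝ}
    (hZ0 : ∀ ω, 0 ≤ Z ω) (hZM : ∀ ω, Z ω ≤ M')
    (hg : Integrable (fun ω => Z ω * g ω) P)
    (hfg : ∀ ω, Z ω * ∫ y, f y ∂(I.payoff (A.play t ω)) ≤ Z ω * g ω) :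
    ∫ ω, Z ω * f (A.reward t ω) ∂P ≤ ∫ ω, Z ω * g ω ∂P := by
  have hfi := A.integrable_comp_reward t hf hM
  have hZb : ∀ᵐ ω ∂P, ‖Z ω‖ ≤ M' := Filter.Eventually.of_forall fun ω => by
    rw [Real.norm_of_nonneg (hZ0 ω)]; exact hZM ω
  have hpull := condExp_stronglyMeasurable_mul_of_bound (A.history.le t) hZ hfi M' hZb
  have hlaw := A.reward_law t f hf ⟨M, hM⟩
  have h1 : ∫ ω, Z ω * f (A.reward t ω) ∂P =
      ∫ ω, (P[Z * (fun ω => f (A.reward t ω)) | A.history t]) ω ∂P :=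
    (integral_condExp (A.history.le t)).symm
  rw [h1]
  refine integral_mono_ae integrable_condExp hg ?_
  filter_upwards [hpull, hlaw] with ω h2 h3
  rw [h2, Pi.mul_apply, h3]
  exact hfg ω

lemma integrable_expMart (s₀ t : ℕ) (l : ℝ) : Integrable (A.expMart s₀ l t) P :=
  Integrable.of_bound ((A.measurable_expMart s₀ t l).mono (A.history.le t)
    le_rfl).aestronglyMeasurable _ <| Filter.Eventually.of_forall fun ω => by
      rw [Real.norm_of_nonneg (A.expMart_nonneg _ _ _ _)]; exact A.expMart_le _ _ _ _

lemma integral_expMart_le_one (s₀ t : ℕ) (l : ℝ) : ∫ ω, A.expMart s₀ l t ω ∂P ≤ 1 := by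
  classical
  rcases le_total t s₀ with ht | ht
  · simp [expMart, Finset.Ico_eq_empty_of_le ht]
  induction t, ht using Nat.le_induction with
  | base => simp [expMart]
  | succ t ht ih =>
    refine le_trans ?_ ih
    set Q : Set Ω := {ω | A.play t ω = A.play s₀ ω} with hQ
    have hQm := A.measurableSet_play_eq ht
    set c : Ω → ℝ := fun ω => Real.exp (-(l * I.μ (A.play t ω)) - l ^ 2 / 8) with hc
    have hcm : Measurable[A.history t] c :=
      Real.measurable_exp.comp
        (((A.stronglyMeasurable_μ_play t).measurable.const_mul l).neg.sub_const _)
    have hcb : ∀ ω, c ω ≤ Real.exp |l| := fun ω => by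
      refine Real.exp_le_exp.2 ?_
      have h2 := I.μ_mem_Icc (A.play t ω)
      have := neg_le_abs (l * I.μ (A.play t ω))
      rw [abs_mul, abs_of_nonneg h2.1] at this
      nlinarith [abs_nonneg l, sq_nonneg l, h2.1, h2.2]
    set Z : Ω → ℝ := Q.indicator fun ω => A.expMart s₀ l t ω * c ω with hZ
    have hZm : Measurable[A.history t] Z :=
      ((A.measurable_expMart s₀ t l).mul hcm).indicator hQm
    have hW0 := A.expMart_nonneg s₀ t l
    have hWi := A.integrable_expMart s₀ t l
    have hQm' : MeasurableSet Q := A.history.le t _ hQm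
    have hZg : ∀ ω, Z ω * Real.exp (l * I.μ (A.play t ω) + l ^ 2 / 8) =
        Q.indicator (A.expMart s₀ l t) ω := fun ω => by
      by_cases hω : ω ∈ Q
      · simp only [hZ, Set.indicator_of_mem hω, hc]
        rw [mul_assoc, ← Real.exp_add]
        ring_nf
        simp
      · simp [hZ, Set.indicator_of_notMem hω]
    have hZ0 : ∀ ω, 0 ≤ Z ω := fun ω =>
      Set.indicator_nonneg (fun ω _ => mul_nonneg (hW0 ω) (Real.exp_pos _).le) ω
    have hM' : 0 ≤ Real.exp |l| ^ (Finset.Ico s₀ t).card * Real.exp |l| := by positivity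
    have hZM : ∀ ω, Z ω ≤ Real.exp |l| ^ (Finset.Ico s₀ t).card * Real.exp |l| := fun ω => by
      refine Set.indicator_le' (fun ω _ => ?_) (fun ω _ => hM') ω
      exact mul_le_mul (A.expMart_le s₀ t l ω) (hcb ω) (Real.exp_pos _).le (by positivity)
    have hfm : Measurable fun y => Real.exp (l * clamp y) :=
      Real.measurable_exp.comp (measurable_clamp.const_mul l)
    have hfb : ∀ y, |Real.exp (l * clamp y)| ≤ Real.exp |l| := fun y => by
      rw [abs_of_pos (Real.exp_pos _), Real.exp_le_exp]
      have h1 := clamp_mem_Icc y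
      have := le_abs_self (l * clamp y)
      rw [abs_mul, abs_of_nonneg h1.1] at this
      nlinarith [abs_nonneg l, h1.1, h1.2]
    have hstep := A.integral_mul_comp_reward_le t hfm hfb hZm.stronglyMeasurable hZ0 hZM
      (g := fun ω => Real.exp (l * I.μ (A.play t ω) + l ^ 2 / 8))
      (by simp_rw [hZg]; exact hWi.indicator hQm')
      (fun ω => mul_le_mul_of_nonneg_left (integral_exp_clamp_payoff_le I _ l) (hZ0 ω))
    have hZint : Integrable (fun ω => Z ω * Real.exp (l * clamp (A.reward t ω))) P :=
      (A.integrable_comp_reward t hfm hfb).bdd_mul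
        (hZm.mono (A.history.le t) le_rfl).aestronglyMeasurable
        (Filter.Eventually.of_forall fun ω => by
          rw [Real.norm_of_nonneg (hZ0 ω)]; exact hZM ω)
    have hsplit : ∀ ω, A.expMart s₀ l (t + 1) ω =
        Z ω * Real.exp (l * clamp (A.reward t ω)) + Qᶜ.indicator (A.expMart s₀ l t) ω := by
      intro ω
      have h1 : A.expMart s₀ l (t + 1) ω = A.expMart s₀ l t ω * A.tilt s₀ l t ω :=
        Finset.prod_Ico_succ_top ht _
      rw [h1]
      by_cases hω : ω ∈ Q
      · have h2 : A.tilt s₀ l t ω =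
            Real.exp (l * (clamp (A.reward t ω) - I.μ (A.play t ω)) - l ^ 2 / 8) := if_pos hω
        rw [Set.indicator_of_notMem (by simpa using hω), hZ, Set.indicator_of_mem hω, h2,
          mul_assoc, ← Real.exp_add, add_zero]
        congr 2
        ring
      · have h2 : A.tilt s₀ l t ω = 1 := if_neg hω
        rw [Set.indicator_of_mem (by simpa using hω), hZ, Set.indicator_of_notMem hω, h2]
        ring
    calc ∫ ω, A.expMart s₀ l (t + 1) ω ∂P
        = ∫ ω, Z ω * Real.exp (l * clamp (A.reward t ω)) ∂P +
            ∫ ω, Qᶜ.indicator (A.expMart s₀ l t) ω ∂P := by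
          simp_rw [hsplit]
          exact integral_add hZint (hWi.indicator hQm'.compl)
      _ ≤ ∫ ω, Q.indicator (A.expMart s₀ l t) ω ∂P +
            ∫ ω, Qᶜ.indicator (A.expMart s₀ l t) ω ∂P := by
          simp_rw [hZg] at hstep
          linarith
      _ = ∫ ω, A.expMart s₀ l t ω ∂P := by
          rw [integral_indicator hQm', integral_indicator hQm'.compl]
          exact integral_add_compl hQm' hWi

lemma measureReal_le_expMart_le (s₀ t : ℕ) (l c : ℝ) :
    P.real {ω | Real.exp c ≤ A.expMart s₀ l t ω} ≤ Real.exp (-c) := by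
  have h1 := mul_meas_ge_le_integral_of_nonneg
    (Filter.Eventually.of_forall (A.expMart_nonneg s₀ t l)) (A.integrable_expMart s₀ t l)
    (Real.exp c)
  have h2 := h1.trans (A.integral_expMart_le_one s₀ t l)
  rw [Real.exp_neg, ← one_div, le_div_iff₀ (Real.exp_pos c)]
  linarith

/-- There are at most `2 * 8 ^ i` supermartingales, and each reaches `exp (16 i / 3)` with
probability at most `exp (-16 i / 3)`. -/
lemma measureReal_badEvent_le {i b : ℕ} (hb : b + 2 ≤ 2 ^ (i + 1)) (hi : 1 ≤ i) :
    P.real (A.badEvent i b) * 2 ^ i ≤ 1 := by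
  have h1 : P.real (A.badEvent i b) ≤ (2 ^ i * 2 ^ i * (2 ^ i * 2)) * Real.exp (-(16 * i / 3)) := by
    refine (measureReal_biUnion_finset_le _ _).trans ?_
    refine (Finset.sum_le_card_nsmul _ _ _ fun p _ =>
      A.measureReal_le_expMart_le p.1.1 p.1.2 _ _).trans ?_
    rw [nsmul_eq_mul]
    refine mul_le_mul_of_nonneg_right ?_ (Real.exp_pos _).le
    have h2 : b - (2 ^ i - 2) ≤ 2 ^ i := by
      have : 2 ≤ 2 ^ i := by simpa using Nat.pow_le_pow_right (show 0 < 2 by norm_num) hi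
      rw [pow_succ] at hb
      omega
    have h3 : ({1, -1} : Finset ℝ).card = 2 := Finset.card_pair (by norm_num)
    rw [Finset.card_product, Finset.card_product, Finset.card_product, h3, Nat.card_Ico,
      Nat.card_Icc, Nat.add_sub_cancel]
    exact_mod_cast Nat.mul_le_mul_right _ (Nat.mul_le_mul h2 h2)
  have h4 : (32 : ℝ) ^ i ≤ Real.exp (16 * i / 3) := by
    have h5 : (2 : ℝ) ≤ Real.exp 1 := by
      have := Real.add_one_le_exp 1; linarith
    calc (32 : ℝ) ^ i = (2 ^ 5) ^ i := by norm_num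
      _ ≤ (Real.exp 1 ^ 5) ^ i := by gcongr
      _ = Real.exp (5 * i) := by
          rw [← pow_mul, ← Real.exp_nat_mul]; push_cast; ring_nf
      _ ≤ _ := Real.exp_le_exp.2 (by
          have : (0 : ℝ) ≤ i := by positivity
          linarith)
  have h6 : (2 : ℝ) * 16 ^ i ≤ 32 ^ i := by
    have : (32 : ℝ) ^ i = 2 ^ i * 16 ^ i := by rw [← mul_pow]; norm_num
    rw [this]
    gcongr
    simpa using pow_le_pow_right₀ (one_le_two (α := ℝ)) hi
  calc P.real (A.badEvent i b) * 2 ^ i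
      ≤ (2 ^ i * 2 ^ i * (2 ^ i * 2)) * Real.exp (-(16 * i / 3)) * 2 ^ i := by gcongr
    _ = 2 * 16 ^ i * Real.exp (-(16 * i / 3)) := by
        have : (16 : ℝ) ^ i = 2 ^ i * 2 ^ i * 2 ^ i * 2 ^ i := by
          rw [← mul_pow, ← mul_pow, ← mul_pow]; norm_num
        rw [this]; ring
    _ ≤ Real.exp (16 * i / 3) * Real.exp (-(16 * i / 3)) := by
        gcongr; exact h6.trans h4
    _ = 1 := by rw [← Real.exp_add, add_neg_cancel, Real.exp_zero]

end Run

end Probability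

end

end Zooming

/-! ### The regret bound -/

namespace Zooming

/-- The lengths of the phases grow geometrically, which the hypothesis on the square roots
expresses. Jensen's inequality with the exponent `1 / (2 α)` then bounds the loss from summing over
the phases by a factor of the form `const ^ α`. -/
lemma sum_rpow_le {ι : Type*} (s : Finset ι) (T : ι → ℝ) (hT : ∀ i ∈ s, 0 ≤ T i) {t : ℝ}
    (ht : 0 < t) (hsum : ∑ i ∈ s, T i = t) (hsqrt : ∑ i ∈ s, √(T i) ≤ 5 * √t) {α : ℝ}
    (hα : 0 < α) (hα2 : α ≤ 1 / 2) :
    ∑ i ∈ s, T i ^ (1 - α) ≤ 25 ^ α * t ^ (1 - α) := by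
  have hp : 1 ≤ 1 / (2 * α) := by rw [le_div_iff₀ (by linarith)]; linarith
  have hw0 : ∀ i ∈ s, 0 ≤ T i / t := fun i hi => div_nonneg (hT i hi) ht.le
  have hw1 : ∑ i ∈ s, T i / t = 1 := by rw [← Finset.sum_div, hsum, div_self ht.ne']
  have hJ := Real.rpow_arith_mean_le_arith_mean_rpow s (fun i => T i / t)
    (fun i => (T i / t) ^ (-α)) hw0 hw1 (fun i hi => Real.rpow_nonneg (hw0 i hi) _) hp
  have h1 : ∀ i ∈ s, T i / t * (T i / t) ^ (-α) = T i ^ (1 - α) / t ^ (1 - α) := by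
    intro i hi
    rw [← Real.div_rpow (hT i hi) ht.le]
    rcases (hw0 i hi).eq_or_lt with h0 | h0
    · rw [← h0, zero_mul, Real.zero_rpow (by linarith)]
    · rw [sub_eq_add_neg, Real.rpow_add h0, Real.rpow_one]
  have h2 : ∀ i ∈ s, T i / t * ((T i / t) ^ (-α)) ^ (1 / (2 * α)) = √(T i) / √t := by
    intro i hi
    rw [← Real.rpow_mul (hw0 i hi), show -α * (1 / (2 * α)) = -(1 / 2) by field_simp,
      ← Real.sqrt_div (hT i hi)]
    rcases (hw0 i hi).eq_or_lt with h0 | h0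
    · rw [← h0]; simp
    · rw [Real.rpow_neg h0.le, ← Real.sqrt_eq_rpow, ← div_eq_mul_inv, Real.div_sqrt]
  rw [Finset.sum_congr rfl h1, Finset.sum_congr rfl h2, ← Finset.sum_div, ← Finset.sum_div] at hJ
  have h5 : (∑ i ∈ s, √(T i)) / √t ≤ 5 := by
    rwa [div_le_iff₀ (Real.sqrt_pos.2 ht)]
  have hnn : 0 ≤ (∑ i ∈ s, T i ^ (1 - α)) / t ^ (1 - α) :=
    div_nonneg (Finset.sum_nonneg fun i hi => Real.rpow_nonneg (hT i hi) _) (by positivity)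
  have h6 := Real.rpow_le_rpow (Real.rpow_nonneg hnn _) (hJ.trans h5)
    (show 0 ≤ 2 * α by linarith)
  rw [← Real.rpow_mul hnn, one_div_mul_cancel (by positivity), Real.rpow_one,
    div_le_iff₀ (by positivity), Real.rpow_mul (by norm_num)] at h6
  norm_num at h6
  exact h6

lemma sum_sqrt_two_pow_le (m : ℕ) : ∑ i ∈ Finset.Icc 1 m, √((2 : ℝ) ^ i) ≤ 4 * √(2 ^ m) := by
  have hs : ∀ i : ℕ, √((2 : ℝ) ^ (i + 1)) = √(2 ^ i) * √2 := fun i => by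
    rw [pow_succ, Real.sqrt_mul (by positivity)]
  have h2 : (4 / 3 : ℝ) ≤ √2 := by
    rw [Real.le_sqrt (by norm_num) (by norm_num)]; norm_num
  induction m with
  | zero => simp
  | succ m ih =>
    rw [Finset.sum_Icc_succ_top (by omega), hs]
    nlinarith [Real.sqrt_nonneg ((2 : ℝ) ^ m)]

namespace Run

variable {X : Type*} [MetricSpace X] {I : LipschitzMAB X} {Ω : Type*} [mΩ : MeasurableSpace Ω]
  {P : Measure Ω} [IsProbabilityMeasure P]

/-- The regret of one phase of `T` rounds. The level `δ` balances `T δ` against the regret of the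
plays with larger gaps. Both the latter and the bad event cost a fraction at most `1 / (d + 2)` of
`T δ`, so that the constant stays under the exponent `1 / (d + 2)`. -/
lemma sum_integral_gap_phase_le (A : Run I P) {C d : ℝ} (hC : 0 < C) (hd : 0 ≤ d)
    (hcov : I.ZoomingCovers C d) {i b : ℕ} (hb : b + 2 ≤ 2 ^ (i + 1)) (hi : 1 ≤ i) {l : ℝ}
    (hl : (i : ℝ) ≤ 3 * l) :
    ∑ s ∈ Finset.Ico (2 ^ i - 2) b, ∫ ω, I.gap (A.play s ω) ∂P ≤
      (1 + 2 * (1 / (d + 2))) * ((1728 * C * l) ^ (1 / (d + 2)) *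
        ((Finset.Ico (2 ^ i - 2) b).card : ℝ) ^ (1 - 1 / (d + 2))) := by
  set F := Finset.Ico (2 ^ i - 2) b with hF
  set α := 1 / (d + 2) with hα
  have hd2 : 0 < d + 2 := by linarith
  have hα0 : 0 < α := by positivity
  have hα1 : α ≤ 1 := by rw [hα, div_le_one hd2]; linarith
  have hiR : (1 : ℝ) ≤ i := by exact_mod_cast hi
  have hl0 : 0 < l := by linarith
  rcases F.eq_empty_or_nonempty with h0 | h0
  · rw [h0, Finset.sum_empty]
    positivity
  set T : ℝ := (F.card : ℝ) with hT
  have hT1 : 1 ≤ T := by rw [hT]; exact_mod_cast h0.card_pos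
  have hT0 : 0 < T := by linarith
  have hT2 : T ≤ 2 ^ i := by
    have : F.card ≤ 2 ^ i := by
      rw [hF, Nat.card_Ico]
      have : 2 ≤ 2 ^ i := by simpa using Nat.pow_le_pow_right (show 0 < 2 by norm_num) hi
      rw [pow_succ] at hb
      omega
    rw [hT]; exact_mod_cast this
  set δ : ℝ := (1728 * C * l / T) ^ α with hδ
  have hδ0 : 0 < δ := by positivity
  have hδpow : δ ^ (d + 2) = 1728 * C * l / T := by
    rw [hδ, ← Real.rpow_mul (by positivity), hα, one_div_mul_cancel hd2.ne', Real.rpow_one]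
  have hTδ : T * δ = (1728 * C * l) ^ α * T ^ (1 - α) := by
    rw [hδ, Real.div_rpow (by positivity) hT0.le, Real.rpow_sub hT0, Real.rpow_one]
    ring
  rw [← hTδ]
  have hgi : ∀ s ∈ F, Integrable (fun ω => I.gap (A.play s ω)) P :=
    fun s _ => A.integrable_gap_play s
  rcases le_or_gt 1 δ with hδ1 | hδ1
  · have h1 : ∑ s ∈ F, ∫ ω, I.gap (A.play s ω) ∂P ≤ T * 1 := by
      rw [hT, ← nsmul_eq_mul]
      refine Finset.sum_le_card_nsmul _ _ _ fun s _ => ?_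
      have := integral_mono (A.integrable_gap_play s) (integrable_const (1 : ℝ))
        fun ω => I.gap_le_one (A.play s ω)
      simpa using this
    have h2 : T * 1 ≤ T * δ := by gcongr
    have h3 : 0 ≤ α * (T * δ) := by positivity
    linarith
  have hexc : 576 * i * C * α * δ ^ (-(d + 1)) ≤ α * δ * T := by
    have h1 : δ ^ (-(d + 1)) = δ * (δ ^ (d + 2))⁻¹ := by
      rw [← Real.rpow_neg hδ0.le, show -(d + 1) = 1 + -(d + 2) by ring, Real.rpow_add hδ0,
        Real.rpow_one]
    rw [h1, hδpow, inv_div, ← mul_assoc, ← mul_div_assoc, div_le_iff₀ (by positivity)]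
    have h2 : 0 ≤ C * α * δ * T := by positivity
    nlinarith
  -- `Δ ^ (d + 2) ≤ C ≤ T δ ^ (d + 2)` gives `Δ ≤ T ^ α δ`, and `T ^ α ≤ 1 + α (T - 1)`
  have hgap : ∀ x, max (I.gap x - δ) 0 ≤ α * δ * T := by
    intro x
    refine max_le ?_ (by positivity)
    rcases le_or_gt (I.gap x) δ with hx | hx
    · have : 0 ≤ α * δ * T := by positivity
      linarith
    have hx0 : 0 < I.gap x := hδ0.trans hx
    have h1 : I.gap x ^ (d + 2) ≤ T * δ ^ (d + 2) := by
      have h2 := hcov.gap_rpow_le hx0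
      have h3 : I.gap x ^ (2 : ℝ) ≤ 1 :=
        Real.rpow_le_one hx0.le (I.gap_le_one x) (by norm_num)
      rw [Real.rpow_add hx0, hδpow, mul_div_cancel₀ _ hT0.ne']
      have h4 : I.gap x ^ d * I.gap x ^ (2 : ℝ) ≤ C * 1 :=
        mul_le_mul h2 h3 (by positivity) hC.le
      nlinarith
    have h5 := Real.rpow_le_rpow (by positivity) h1 hα0.le
    rw [Real.mul_rpow hT0.le (by positivity), ← Real.rpow_mul hx0.le, ← Real.rpow_mul hδ0.le, hα,
      mul_one_div_cancel hd2.ne', Real.rpow_one, Real.rpow_one, ← hα] at h5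
    have h6 := rpow_one_add_le_one_add_mul_self (s := T - 1) (by linarith) hα0.le hα1
    rw [add_sub_cancel] at h6
    have h7 := mul_le_mul_of_nonneg_right h6 hδ0.le
    nlinarith [mul_pos hα0 hδ0]
  have hpt : ∀ᵐ ω ∂P, ∑ s ∈ F, I.gap (A.play s ω) ≤
      T * δ + α * δ * T + (A.badEvent i b).indicator (fun _ => α * δ * T * T) ω := by
    filter_upwards [A.trace, A.reward_mem_Icc] with ω htr hrw
    have h1 : ∑ s ∈ F, I.gap (A.play s ω) ≤
        T * δ + ∑ s ∈ F, max (I.gap (A.play s ω) - δ) 0 := by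
      rw [hT, ← nsmul_eq_mul, ← Finset.sum_const, ← Finset.sum_add_distrib]
      refine Finset.sum_le_sum fun s _ => ?_
      linarith [le_max_left (I.gap (A.play s ω) - δ) 0]
    have h2 : 0 ≤ α * δ * T := by positivity
    by_cases hω : ω ∈ A.badEvent i b
    · rw [Set.indicator_of_mem hω]
      have h3 := Finset.sum_le_card_nsmul F (fun s => max (I.gap (A.play s ω) - δ) 0) _
        fun s _ => hgap _
      rw [nsmul_eq_mul, ← hT] at h3
      linarith
    · rw [Set.indicator_of_notMem hω]
      have h3 := htr.sum_excess_le hb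
        (fun s hs => A.clean_of_notMem_badEvent hb hi hrw hω hs) hC hd hcov hδ0 hδ1.le
      linarith
  rw [← integral_finsetSum _ hgi]
  have hm := A.measurableSet_badEvent i b
  have h1 := integral_mono_ae (integrable_finsetSum _ hgi)
    ((integrable_const (T * δ + α * δ * T)).add
      ((integrable_const (α * δ * T * T)).indicator hm)) hpt
  refine h1.trans ?_
  simp only [Pi.add_apply]
  rw [integral_add (integrable_const _) ((integrable_const _).indicator hm),
    integral_indicator_const _ hm]
  simp only [integral_const, probReal_univ, smul_eq_mul, one_mul]
  have h2 : P.real (A.badEvent i b) * T ≤ 1 :=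
    (mul_le_mul_of_nonneg_left hT2 measureReal_nonneg).trans (A.measureReal_badEvent_le hb hi)
  have h3 : 0 ≤ α * δ * T := by positivity
  nlinarith

lemma regret_le_of_zoomingCovers (A : Run I P) {C d : ℝ} (hC : 0 < C) (hd : 0 ≤ d)
    (hcov : I.ZoomingCovers C d) {t : ℕ} (ht : 2 ≤ t) :
    A.regret t ≤ (1728 * 25 * Real.exp 2 * C * Real.log t) ^ (1 / (d + 2)) *
      (t : ℝ) ^ (1 - 1 / (d + 2)) := by
  set m := phase (t - 1) with hm
  have hm2 : 2 ^ m ≤ t + 1 := by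
    have := (phase_le (s := t - 1) rfl).1
    rw [← hm] at this
    omega
  have hfib : ∀ i, (Finset.range t).filter (fun s => phase s = i) =
      (Finset.Ico (2 ^ i - 2) (min t (2 ^ (i + 1) - 2))) := by
    intro i
    ext s
    simp only [Finset.mem_filter, Finset.mem_range, Finset.mem_Ico, lt_min_iff]
    have : 1 ≤ 2 ^ i := Nat.one_le_two_pow
    have h2 := pow_succ 2 i
    constructor
    · rintro ⟨h1, h3⟩
      have := phase_le h3
      omega
    · rintro ⟨h1, h3, h4⟩
      exact ⟨h3, phase_eq_of_mem_Ico (b := s + 1) (by omega) (Finset.mem_Ico.2 ⟨h1, by omega⟩)⟩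
  have hmaps : ∀ s ∈ Finset.range t, phase s ∈ Finset.Icc 1 m := fun s hs => by
    rw [Finset.mem_range] at hs
    exact Finset.mem_Icc.2 ⟨one_le_phase s, Nat.log_mono_right (by omega)⟩
  set T : ℕ → ℝ := fun i => ((Finset.Ico (2 ^ i - 2) (min t (2 ^ (i + 1) - 2))).card : ℝ) with hT
  have ht0 : (0 : ℝ) < t := by positivity
  have htR : (2 : ℝ) ≤ t := by exact_mod_cast ht
  have hmR : (2 : ℝ) ^ m ≤ t + 1 := by exact_mod_cast hm2
  have hTsum : ∑ i ∈ Finset.Icc 1 m, T i = t := by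
    have h1 := Finset.card_eq_sum_card_fiberwise (t := Finset.Icc 1 m) (f := phase)
      (s := Finset.range t) hmaps
    rw [Finset.card_range] at h1
    conv_rhs => rw [h1]
    push_cast
    exact Finset.sum_congr rfl fun i _ => by rw [hfib]
  have hTle : ∀ i ∈ Finset.Icc 1 m, T i ≤ 2 ^ i := by
    intro i hi
    have h1 : 2 ≤ 2 ^ i := by
      simpa using Nat.pow_le_pow_right (show 0 < 2 by norm_num) (Finset.mem_Icc.1 hi).1
    have h2 := pow_succ 2 i
    have h3 : (Finset.Ico (2 ^ i - 2) (min t (2 ^ (i + 1) - 2))).card ≤ 2 ^ i := by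
      rw [Nat.card_Ico]; omega
    simp only [hT]
    exact_mod_cast h3
  have hsqrt : ∑ i ∈ Finset.Icc 1 m, √(T i) ≤ 5 * √t := by
    calc ∑ i ∈ Finset.Icc 1 m, √(T i) ≤ ∑ i ∈ Finset.Icc 1 m, √((2 : ℝ) ^ i) :=
          Finset.sum_le_sum fun i hi => Real.sqrt_le_sqrt (hTle i hi)
      _ ≤ 4 * √(2 ^ m) := sum_sqrt_two_pow_le m
      _ ≤ 4 * (5 / 4 * √t) := by
          gcongr
          rw [Real.sqrt_le_left (by positivity), mul_pow, Real.sq_sqrt ht0.le]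
          linarith
      _ = 5 * √t := by ring
  have hlog : (m : ℝ) ≤ 3 * Real.log t := by
    have h1 : (2 : ℝ) ^ m ≤ (t : ℝ) ^ 2 := by nlinarith
    have h2 := Real.log_le_log (by positivity) h1
    rw [Real.log_pow, Real.log_pow] at h2
    have h3 := Real.log_two_gt_d9
    have h4 : (0 : ℝ) ≤ m := by positivity
    push_cast at h2
    nlinarith
  have hl0 : 0 < Real.log t := Real.log_pos (by linarith)
  set α := 1 / (d + 2) with hα
  have hα0 : 0 < α := by positivity
  have hα2 : α ≤ 1 / 2 := one_div_le_one_div_of_le (by norm_num) (by linarith)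
  have hphase : ∀ i ∈ Finset.Icc 1 m,
      ∑ s ∈ Finset.range t with phase s = i, ∫ ω, I.gap (A.play s ω) ∂P ≤
        (1 + 2 * α) * ((1728 * C * Real.log t) ^ α * T i ^ (1 - α)) := by
    intro i hi
    rw [hfib]
    have h1 := Finset.mem_Icc.1 hi
    have h3 : 2 ≤ 2 ^ (i + 1) := by
      simpa using Nat.pow_le_pow_right (show 0 < 2 by norm_num) (show 1 ≤ i + 1 by omega)
    have h4 : (i : ℝ) ≤ m := by exact_mod_cast h1.2
    exact A.sum_integral_gap_phase_le hC hd hcov (by omega) h1.1 (h4.trans hlog)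
  rw [A.regret_eq_sum_integral_gap, ← Finset.sum_fiberwise_of_maps_to hmaps]
  refine (Finset.sum_le_sum hphase).trans ?_
  rw [← Finset.mul_sum, ← Finset.mul_sum]
  have hT0 : ∀ i, 0 ≤ T i := fun i => Nat.cast_nonneg _
  clear_value T α m
  have hJ := sum_rpow_le (Finset.Icc 1 m) T (fun i _ => hT0 i) ht0 hTsum hsqrt hα0 hα2
  have hexp : 1 + 2 * α ≤ Real.exp 2 ^ α := by
    rw [← Real.exp_mul]
    linarith [Real.add_one_le_exp (2 * α)]
  calc (1 + 2 * α) * ((1728 * C * Real.log t) ^ α * ∑ i ∈ Finset.Icc 1 m, T i ^ (1 - α))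
      ≤ Real.exp 2 ^ α * ((1728 * C * Real.log t) ^ α * (25 ^ α * (t : ℝ) ^ (1 - α))) := by
        refine mul_le_mul hexp (mul_le_mul_of_nonneg_left hJ (by positivity)) ?_ (by positivity)
        exact mul_nonneg (by positivity)
          (Finset.sum_nonneg fun i _ => Real.rpow_nonneg (hT0 i) _)
    _ = _ := by
        rw [show 1728 * 25 * Real.exp 2 * C * Real.log t =
          Real.exp 2 * ((1728 * C * Real.log t) * 25) by ring,
          Real.mul_rpow (x := Real.exp 2) (by positivity) (by positivity),
          Real.mul_rpow (x := 1728 * C * Real.log t) (by positivity) (by norm_num)]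
        ring

lemma regret_le (A : Run I P) (t : ℕ) : A.regret t ≤ t := by
  rw [A.regret_eq_sum_integral_gap]
  have h := Finset.sum_le_card_nsmul (Finset.range t)
    (fun s => ∫ ω, I.gap (A.play s ω) ∂P) 1 fun s _ => by
      have := integral_mono (A.integrable_gap_play s) (integrable_const (1 : ℝ))
        fun ω => I.gap_le_one (A.play s ω)
      simpa using this
  simpa using h

end Run

end Zooming

theorem mainTheorem2 :
    ∃ K : ℝ, 0 < K ∧
      ∀ (X : Type*) [MetricSpace X] (I : LipschitzMAB X)
        (Ω : Type*) [MeasurableSpace Ω] (P : Measure Ω) [IsProbabilityMeasure P]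
        (A : Zooming.Run I P) (C : ℝ), 0 < C → ∀ t : ℕ, 2 ≤ t →
          A.regret t ≤
            (K * C * Real.log t) ^ (1 / (2 + I.zoomingDim C)).toReal *
              (t : ℝ) ^ (1 - (1 / (2 + I.zoomingDim C)).toReal) := by
  refine ⟨1728 * 25 * Real.exp 2, by positivity, ?_⟩
  intro X _ I Ω _ P _ A C hC t ht
  by_cases htop : I.zoomingDim C = ∞
  · simpa [htop] using A.regret_le t
  · have h : (1 / (2 + I.zoomingDim C)).toReal = 1 / ((I.zoomingDim C).toReal + 2) := by
      rw [ENNReal.toReal_div, ENNReal.toReal_add (by norm_num) htop]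
      simp [add_comm]
    rw [h]
    exact A.regret_le_of_zoomingCovers hC ENNReal.toReal_nonneg
      (I.zoomingCovers_zoomingDim hC htop) ht
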